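/- Let $M\ge 1$ be an integer, $L=\sqrt M\,\mathbb Z$, $L'=\tfrac1{\sqrt M}\mathbb Z$, and $q=e^{2\pi i\tau}$ for $\tau$ in the upper half-plane $\mathbb H$. All square roots and non-integral powers are principal, so $\arg\sqrt z\in(-\pi/2,\pi/2]$. For an integer $k\ge 0$ and $\mu\in L'/L$ put $$\theta_{k,\mu}(\tau)=\sum_{n\in L+\mu}n^k q^{n^2/2},\qquad \widetilde\theta_{k,\mu}(\tau)=\sum_{n\in L+\mu}\operatorname{sgn}(n)\,n^k q^{n^2/2},\qquad \operatorname{sgn}(0)=0 .$$ Let $d\ge 2$ be an integer, $\boldsymbol\mu=(\mu_j)_{1\le j\le d}\in (L'/L)^d$, and let $\boldsymbol a=(a_j)_{1\le j\le d}\in\mathbb C^d$ satisfy $\sum_{j=1}^d a_j=0$. Put $$\widetilde\theta_{k,\boldsymbol\mu,\boldsymbol a}(\tau)=\sum_{j=1}^d a_j\widetilde\theta_{k,\mu_j}(\tau),\qquad \theta_{k,\boldsymbol\mu,\boldsymbol a}(\tau)=\sum_{j=1}^d a_j\theta_{k,\mu_j}(\tau).$$ Let $k=2\kappa+\iota$ with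 $\kappa\in\mathbb Z_{\ge0}$ and $\iota\in\{0,1\}$, and let $\tau\in\mathbb H$ with $\operatorname{Re}(\tau)\ne 0$. Then the integral below, taken along the positive imaginary axis, converges absolutely and $$\widetilde\theta_{k,\boldsymbol\mu,\boldsymbol a}\!\left(-\frac1\tau\right)+\operatorname{sgn}(\operatorname{Re}\tau)\,\frac{(-1)^\iota(-i)^{1/2}\tau^{\kappa+\iota+\frac12}}{(2\pi i)^\kappa\sqrt M}\sum_{\nu\in L'/L}\Bigl(\sum_{j=1}^d a_j e^{2\pi i\mu_j\nu}\Bigr)\sum_{r=0}^{\kappa}d_{\kappa,\iota,r}\,\tau^r\,\widetilde\theta_{2r+\iota,\nu}(\tau)=-i\int_0^{i\infty}\frac{\theta_{k+1,\boldsymbol\mu,\boldsymbol a}(z)}{\sqrt{-i(z+1/\tau)}}\,dz,$$ where, for $0\le r\le\kappa$, $$d_{\kappa,\iota,r}=\frac{(4\pi i)^r(2\kappa+\iota)!}{2^\kappa(\kappa-r)!(2r+\iota)!}.$$ -/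

import Mathlib

namespace FalseTheta

open Complex

/-- The lattice `L = √M ℤ` in `ℝ`. -/
noncomputable def lattice (M : ℕ) : AddSubgroup ℝ :=
  AddSubgroup.zmultiples (√(M : ℝ))

/-- The dual lattice `L' = (1/√M) ℤ` in `ℝ`. -/
noncomputable def dualLattice (M : ℕ) : AddSubgroup ℝ :=
  AddSubgroup.zmultiples (1 / √(M : ℝ))

/-- The finite quotient group `L' / L`. -/
abbrev Discr (M : ℕ) : Type :=
  dualLattice M ⧸ (lattice M).addSubgroupOf (dualLattice M)

/-- `L' / L` is finite (it has `M` elements): the classes of `j / √M` exhaust it as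
`j` runs over `0, …, M - 1`. -/
instance finite_discr (M : ℕ) [NeZero M] : Finite (Discr M) := by
  have hM : (0 : ℝ) < M := by exact_mod_cast Nat.pos_of_ne_zero (NeZero.ne M)
  have hs : √(M : ℝ) * √(M : ℝ) = M := Real.mul_self_sqrt hM.le
  have hs0 : √(M : ℝ) ≠ 0 := (Real.sqrt_pos.2 hM).ne'
  refine Finite.of_surjective
    (fun j : Fin M => (QuotientAddGroup.mk
      (⟨((j : ℕ) : ℤ) • (1 / √(M : ℝ)), AddSubgroup.zsmul_mem_zmultiples _ _⟩ :
        dualLattice M) : Discr M)) ?_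
  intro x
  obtain ⟨⟨y, hy⟩, rfl⟩ := QuotientAddGroup.mk_surjective x
  obtain ⟨b, rfl⟩ := AddSubgroup.mem_zmultiples_iff.1 hy
  have hMz : (0 : ℤ) < M := by exact_mod_cast Nat.pos_of_ne_zero (NeZero.ne M)
  have h0 := Int.emod_nonneg b hMz.ne'
  have h1 := Int.emod_lt_of_pos b hMz
  refine ⟨⟨(b % M).toNat, by omega⟩, ?_⟩
  refine QuotientAddGroup.eq.2 ?_
  rw [AddSubgroup.mem_addSubgroupOf]
  refine AddSubgroup.mem_zmultiples_iff.2 ⟨b / M, ?_⟩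
  have h2 : ((b % M).toNat : ℤ) = b % M := Int.toNat_of_nonneg h0
  have h3 : (b : ℝ) = ((b % M : ℤ) : ℝ) + M * ((b / M : ℤ) : ℝ) := by
    exact_mod_cast (Int.emod_add_mul_ediv b M).symm
  simp only [AddSubgroup.coe_add, AddSubgroup.coe_neg, h2, zsmul_eq_mul]
  rw [h3]
  field_simp
  rw [sq, hs]
  ring

noncomputable instance fintype_discr (M : ℕ) [NeZero M] : Fintype (Discr M) :=
  Fintype.ofFinite _

/-- The exponential is insensitive to adding an element of `L` to one factor of `μ ν`. -/
theorem exp_mul_congr (M : ℕ) {x x' y : ℝ} (hy : y ∈ dualLattice M)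
    (h : -x + x' ∈ lattice M) :
    exp (2 * Real.pi * I * (x * y : ℝ)) = exp (2 * Real.pi * I * (x' * y : ℝ)) := by
  obtain ⟨b, rfl⟩ := AddSubgroup.mem_zmultiples_iff.1 hy
  obtain ⟨c, hc⟩ := AddSubgroup.mem_zmultiples_iff.1 h
  have hx : x' = x + c * √(M : ℝ) := by
    rw [← zsmul_eq_mul, hc]; ring
  rcases Nat.eq_zero_or_pos M with rfl | hM
  · simp
  have hs0 : √(M : ℝ) ≠ 0 := (Real.sqrt_pos.2 (by exact_mod_cast hM)).ne'
  refine (exp_eq_exp_iff_exists_int.2 ⟨c * b, ?_⟩).symm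
  have : x' * b • (1 / √(M : ℝ)) = x * b • (1 / √(M : ℝ)) + c * b := by
    rw [hx, zsmul_eq_mul]; field_simp
  rw [this]
  push_cast
  ring

/-- The pairing `e^{2πi μν}` for `μ, ν ∈ L' / L`. -/
noncomputable def pairing {M : ℕ} (μ ν : Discr M) : ℂ :=
  Quotient.liftOn₂' μ ν
    (fun x y : dualLattice M => exp (2 * Real.pi * I * ((x : ℝ) * (y : ℝ) : ℝ)))
    (by
      intro x y x' y' hx hy
      have hx' := QuotientAddGroup.leftRel_apply.1 hx
      have hy' := QuotientAddGroup.leftRel_apply.1 hy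
      rw [AddSubgroup.mem_addSubgroupOf] at hx' hy'
      show exp _ = exp _
      rw [exp_mul_congr M y.2 hx', mul_comm (x' : ℝ), exp_mul_congr M x'.2 hy',
        mul_comm (y' : ℝ)])

/-- The coset `L + μ ⊆ L'` given by a class `μ ∈ L' / L`. -/
abbrev Coset {M : ℕ} (μ : Discr M) : Type :=
  {n : dualLattice M // (QuotientAddGroup.mk n : Discr M) = μ}

/-- The real number underlying an element of the coset `L + μ`. -/
noncomputable abbrev Coset.val {M : ℕ} {μ : Discr M} (n : Coset μ) : ℝ :=
  ((n : dualLattice M) : ℝ)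

/-- The ordinary theta function `θ_{k,μ}(τ) = ∑_{n ∈ L + μ} n^k q^{n²/2}`,
`q = e^{2πiτ}`. -/
noncomputable def theta {M : ℕ} (k : ℕ) (μ : Discr M) (τ : ℂ) : ℂ :=
  ∑' n : Coset μ, (n.val : ℂ) ^ k * exp (2 * Real.pi * I * τ * ((n.val : ℂ) ^ 2 / 2))

/-- The false theta function `θ̃_{k,μ}(τ) = ∑_{n ∈ L + μ} sgn(n) n^k q^{n²/2}`,
`q = e^{2πiτ}`. -/
noncomputable def falseTheta {M : ℕ} (k : ℕ) (μ : Discr M) (τ : ℂ) : ℂ :=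
  ∑' n : Coset μ, (Real.sign n.val : ℂ) * (n.val : ℂ) ^ k *
    exp (2 * Real.pi * I * τ * ((n.val : ℂ) ^ 2 / 2))

/-- The series defining `theta` converges absolutely on the upper half-plane. -/
theorem summable_theta {M : ℕ} [NeZero M] (k : ℕ) (μ : Discr M) {τ : ℂ} (hτ : 0 < τ.im) :
    Summable fun n : Coset μ =>
      ‖(n.val : ℂ) ^ k * exp (2 * Real.pi * I * τ * ((n.val : ℂ) ^ 2 / 2))‖ := by
  have hM : (0 : ℝ) < M := by exact_mod_cast Nat.pos_of_ne_zero (NeZero.ne M)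
  have hs : √(M : ℝ) ^ 2 = M := Real.sq_sqrt hM.le
  have hs0 : 0 < √(M : ℝ) := Real.sqrt_pos.2 hM
  choose f hf using fun n : Coset μ => AddSubgroup.mem_zmultiples_iff.1 n.1.2
  have hinj : Function.Injective f := by
    intro a b h
    apply Subtype.ext
    apply Subtype.ext
    rw [← hf a, ← hf b, h]
  have hsum := ((summable_pow_mul_jacobiTheta₂_term_bound 0
    (div_pos hτ hM) k).mul_left ((1 / √(M : ℝ)) ^ k)).comp_injective hinj
  refine hsum.congr fun n => ?_
  have hn : n.val = f n * (1 / √(M : ℝ)) := by rw [← zsmul_eq_mul, hf n]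
  have hre : (2 * Real.pi * I * τ * ((n.val : ℂ) ^ 2 / 2)).re
      = -Real.pi * (τ.im / M * (f n : ℝ) ^ 2 - 2 * 0 * |f n|) := by
    have : (2 * Real.pi * I * τ * ((n.val : ℂ) ^ 2 / 2))
        = ((Real.pi * n.val ^ 2 : ℝ) : ℂ) * (I * τ) := by
      push_cast; ring
    have e : (1 / √(M : ℝ)) ^ 2 = 1 / M := by rw [div_pow, hs, one_pow]
    rw [this, re_ofReal_mul, I_mul_re, hn, mul_pow, e]
    ring
  rw [norm_mul, norm_pow, norm_exp, hre, norm_real, Real.norm_eq_abs, hn, abs_mul,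
    abs_of_pos (one_div_pos.2 hs0), mul_pow]
  simp only [Function.comp_apply, Int.cast_abs]
  ring

/-- The series defining `falseTheta` converges absolutely on the upper half-plane. -/
theorem summable_falseTheta {M : ℕ} [NeZero M] (k : ℕ) (μ : Discr M) {τ : ℂ}
    (hτ : 0 < τ.im) :
    Summable fun n : Coset μ =>
      ‖(Real.sign n.val : ℂ) * (n.val : ℂ) ^ k *
        exp (2 * Real.pi * I * τ * ((n.val : ℂ) ^ 2 / 2))‖ := by
  refine Summable.of_nonneg_of_le (fun _ => norm_nonneg _) (fun n => ?_)
    (summable_theta k μ hτ)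
  rw [mul_assoc, norm_mul]
  refine mul_le_of_le_one_left (norm_nonneg _) ?_
  rcases Real.sign_apply_eq n.val with h | h | h <;> rw [h] <;> simp

/-- `θ_{k,𝛍,𝐚}(τ) = ∑_j a_j θ_{k,μ_j}(τ)`. -/
noncomputable def thetaComb {M d : ℕ} (k : ℕ) (μ : Fin d → Discr M) (a : Fin d → ℂ)
    (τ : ℂ) : ℂ :=
  ∑ j, a j * theta k (μ j) τ

/-- `θ̃_{k,𝛍,𝐚}(τ) = ∑_j a_j θ̃_{k,μ_j}(τ)`. -/
noncomputable def falseThetaComb {M d : ℕ} (k : ℕ) (μ : Fin d → Discr M) (a : Fin d → ℂ)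
    (τ : ℂ) : ℂ :=
  ∑ j, a j * falseTheta k (μ j) τ

/-- The coefficient `d_{κ,ι,r} = (4πi)^r (2κ+ι)! / (2^κ (κ-r)! (2r+ι)!)` for `0 ≤ r ≤ κ`,
and `0` otherwise. -/
noncomputable def dCoeff (κ ι r : ℕ) : ℂ :=
  if r ≤ κ then
    (4 * Real.pi * I) ^ r * ((2 * κ + ι).factorial : ℂ) /
      (2 ^ κ * ((κ - r).factorial : ℂ) * ((2 * r + ι).factorial : ℂ))
  else 0

/-- The integrand `θ_{k+1,𝛍,𝐚}(z) / √(-i(z + 1/τ))`. The power `1/2` is the principal one,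
with argument in `(-π/2, π/2]`. -/
noncomputable def integrand {M d : ℕ} (k : ℕ) (μ : Fin d → Discr M) (a : Fin d → ℂ)
    (τ z : ℂ) : ℂ :=
  thetaComb (k + 1) μ a z / (-I * (z + 1 / τ)) ^ (1 / 2 : ℂ)

/-- The integral `∫_0^{i∞} f(z) dz` along the positive imaginary axis `z = it`, `t > 0`. -/
noncomputable def integralImagAxis (f : ℂ → ℂ) : ℂ :=
  ∫ t in Set.Ioi (0 : ℝ), f (I * t) * I

end FalseTheta

namespace FalseTheta

open Complex Filter Topology MeasureTheory Set

/-- The point `m / √M` of the dual lattice. -/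
noncomputable def node (M : ℕ) (m : ℤ) : ℝ := m * (1 / √(M : ℝ))

/-- The weighted theta series `∑_m B(m) x_m^k e^{πi x_m² τ}`, `x_m = m / √M`. -/
noncomputable def wTheta (M : ℕ) (B : ℤ → ℂ) (k : ℕ) (τ : ℂ) : ℂ :=
  ∑' m : ℤ, B m * (node M m : ℂ) ^ k * exp (Real.pi * I * τ * (node M m : ℂ) ^ 2)

theorem one_div_sqrt_pos (M : ℕ) [NeZero M] : 0 < 1 / √(M : ℝ) :=
  one_div_pos.2 (Real.sqrt_pos.2 (by exact_mod_cast Nat.pos_of_ne_zero (NeZero.ne M)))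

theorem node_sq (M : ℕ) (m : ℤ) : node M m ^ 2 = (m : ℝ) ^ 2 / M := by
  rw [node, mul_pow, div_pow, one_pow, Real.sq_sqrt (Nat.cast_nonneg M)]
  ring

theorem one_le_node_sq {M : ℕ} [NeZero M] {m : ℤ} (hm : m ≠ 0) : 1 / (M : ℝ) ≤ node M m ^ 2 := by
  rw [node_sq]
  have h : (1 : ℝ) ≤ (m : ℝ) ^ 2 := by
    have := Int.one_le_abs hm
    have h2 : (1 : ℤ) ≤ m ^ 2 := by rw [← sq_abs]; nlinarith
    exact_mod_cast h2
  gcongr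

/-- The real series dominating the theta series of exponent `k` at height `y`. -/
theorem summable_node_bound (M : ℕ) [NeZero M] (k : ℕ) {y : ℝ} (hy : 0 < y) :
    Summable fun m : ℤ => |node M m| ^ k * Real.exp (-Real.pi * y * node M m ^ 2) := by
  have hM : (0 : ℝ) < M := by exact_mod_cast Nat.pos_of_ne_zero (NeZero.ne M)
  refine ((summable_pow_mul_jacobiTheta₂_term_bound 0
    (div_pos hy hM) k).mul_left ((1 / √(M : ℝ)) ^ k)).congr fun m => ?_
  rw [node_sq, node, abs_mul, abs_of_pos (one_div_sqrt_pos M), mul_pow]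
  have : -Real.pi * (y / M * (m : ℝ) ^ 2 - 2 * 0 * |(m : ℝ)|)
    = -Real.pi * y * ((m : ℝ) ^ 2 / M) := by ring
  simp only [Int.cast_abs]
  rw [this]
  ring

theorem norm_exp_node (M : ℕ) (m : ℤ) (τ : ℂ) :
    ‖exp (Real.pi * I * τ * (node M m : ℂ) ^ 2)‖ =
      Real.exp (-Real.pi * τ.im * node M m ^ 2) := by
  rw [norm_exp]
  congr 1
  have : (Real.pi * I * τ * (node M m : ℂ) ^ 2)
      = ((Real.pi * node M m ^ 2 : ℝ) : ℂ) * (I * τ) := by push_cast; ring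
  rw [this, re_ofReal_mul, I_mul_re]
  ring

theorem norm_wTheta_term_le {M : ℕ} {B : ℤ → ℂ} {C : ℝ} (hB : ∀ m, ‖B m‖ ≤ C) (k : ℕ) {τ : ℂ}
    {y : ℝ} (hy : y ≤ τ.im) (m : ℤ) :
    ‖B m * (node M m : ℂ) ^ k * exp (Real.pi * I * τ * (node M m : ℂ) ^ 2)‖ ≤
      C * (|node M m| ^ k * Real.exp (-Real.pi * y * node M m ^ 2)) := by
  have hC : 0 ≤ C := (norm_nonneg _).trans (hB 0)
  rw [norm_mul, norm_mul, norm_pow, norm_real, Real.norm_eq_abs, norm_exp_node, mul_assoc]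
  have := Real.pi_pos
  gcongr ?_ * (_ * Real.exp ?_)
  · exact hB m
  · nlinarith [mul_nonneg this.le (sq_nonneg (node M m))]

theorem summable_wTheta {M : ℕ} [NeZero M] {B : ℤ → ℂ} {C : ℝ} (hB : ∀ m, ‖B m‖ ≤ C) (k : ℕ)
    {τ : ℂ} (hτ : 0 < τ.im) :
    Summable fun m : ℤ =>
      B m * (node M m : ℂ) ^ k * exp (Real.pi * I * τ * (node M m : ℂ) ^ 2) :=
  Summable.of_norm_bounded ((summable_node_bound M k hτ).mul_left C)
    (norm_wTheta_term_le hB k le_rfl)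

theorem isOpen_im_gt (y : ℝ) : IsOpen {τ : ℂ | y < τ.im} :=
  isOpen_lt continuous_const continuous_im

theorem convex_im_gt (y : ℝ) : Convex ℝ {τ : ℂ | y < τ.im} :=
  convex_halfSpace_im_gt y

/-- `θ_k' = πi θ_{k+2}`. -/
theorem hasDerivAt_wTheta {M : ℕ} [NeZero M] {B : ℤ → ℂ} {C : ℝ} (hB : ∀ m, ‖B m‖ ≤ C) (k : ℕ)
    {τ : ℂ} (hτ : 0 < τ.im) :
    HasDerivAt (wTheta M B k) (Real.pi * I * wTheta M B (k + 2) τ) τ := by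
  have hy : 0 < τ.im / 2 := by positivity
  have hyτ : τ ∈ {τ' : ℂ | τ.im / 2 < τ'.im} := half_lt_self hτ
  have key := hasDerivAt_tsum_of_isPreconnected
    (g := fun (m : ℤ) τ => B m * (node M m : ℂ) ^ k * exp (Real.pi * I * τ * (node M m : ℂ) ^ 2))
    (g' := fun (m : ℤ) τ => Real.pi * I *
      (B m * (node M m : ℂ) ^ (k + 2) * exp (Real.pi * I * τ * (node M m : ℂ) ^ 2)))
    (((summable_node_bound M (k + 2) hy).mul_left C).mul_left Real.pi)
    (isOpen_im_gt (τ.im / 2)) (convex_im_gt _).isPreconnected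
    (fun m z hz => ?_) (fun m z hz => ?_) hyτ (summable_wTheta hB k hτ) hyτ
  · rwa [tsum_mul_left] at key
  · have h1 : HasDerivAt (fun z : ℂ => Real.pi * I * z * (node M m : ℂ) ^ 2)
        (Real.pi * I * 1 * (node M m : ℂ) ^ 2) z :=
      ((hasDerivAt_id z).const_mul _).mul_const _
    exact (h1.cexp.const_mul (B m * (node M m : ℂ) ^ k)).congr_deriv (by ring)
  · rw [norm_mul]
    have : ‖(Real.pi : ℂ) * I‖ = Real.pi := by simp [abs_of_pos Real.pi_pos]
    rw [this]
    exact mul_le_mul_of_nonneg_left (norm_wTheta_term_le hB (k + 2) (le_of_lt hz) m)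
      Real.pi_pos.le

theorem continuousOn_wTheta {M : ℕ} [NeZero M] {B : ℤ → ℂ} {C : ℝ} (hB : ∀ m, ‖B m‖ ≤ C)
    (k : ℕ) : ContinuousOn (wTheta M B k) {τ : ℂ | 0 < τ.im} :=
  fun _ hτ => (hasDerivAt_wTheta hB k hτ).continuousAt.continuousWithinAt

/-- Along the imaginary axis, `d/dt θ_k(it) = -π θ_{k+2}(it)`. -/
theorem hasDerivAt_wTheta_axis {M : ℕ} [NeZero M] {B : ℤ → ℂ} {C : ℝ} (hB : ∀ m, ‖B m‖ ≤ C)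
    (k : ℕ) {t : ℝ} (ht : 0 < t) :
    HasDerivAt (fun t : ℝ => wTheta M B k (I * t)) (-Real.pi * wTheta M B (k + 2) (I * t)) t := by
  have h1 : HasDerivAt (fun t : ℝ => I * (t : ℂ)) (I * 1) t :=
    (hasDerivAt_id t).ofReal_comp.const_mul I
  have h2 := HasDerivAt.comp t (hasDerivAt_wTheta (M := M) hB k (τ := I * t) (by simpa using ht)) h1
  exact h2.congr_deriv (by
    linear_combination (Real.pi : ℂ) * wTheta M B (k + 2) (I * t) * I_sq)

theorem continuousOn_wTheta_axis {M : ℕ} [NeZero M] {B : ℤ → ℂ} {C : ℝ} (hB : ∀ m, ‖B m‖ ≤ C)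
    (k : ℕ) : ContinuousOn (fun t : ℝ => wTheta M B k (I * t)) (Ioi 0) :=
  fun _ ht => (hasDerivAt_wTheta_axis hB k ht).continuousAt.continuousWithinAt

/-- A term of a theta series without constant term decays exponentially. -/
theorem node_bound_decay {M : ℕ} [NeZero M] (k : ℕ) {t y : ℝ} (ht : y ≤ t) {m : ℤ}
    (hm : m ≠ 0) :
    |node M m| ^ k * Real.exp (-Real.pi * t * node M m ^ 2) ≤
      |node M m| ^ k * Real.exp (-Real.pi * y * node M m ^ 2) *
        Real.exp (-(Real.pi / M) * (t - y)) := by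
  rw [mul_assoc (|node M m| ^ k), ← Real.exp_add]
  gcongr
  have h := one_le_node_sq (M := M) hm
  have h1 : 0 ≤ Real.pi * (t - y) := mul_nonneg Real.pi_pos.le (sub_nonneg.2 ht)
  have := mul_le_mul_of_nonneg_left h h1
  have e : Real.pi * (t - y) * (1 / M) = (Real.pi / M) * (t - y) := by ring
  rw [e] at this
  linarith

/-- Exponential decay of a theta series without constant term. -/
theorem norm_wTheta_axis_le {M : ℕ} [NeZero M] {B : ℤ → ℂ} {C : ℝ} (hB : ∀ m, ‖B m‖ ≤ C)
    (k : ℕ) (h0 : B 0 * (0 : ℂ) ^ k = 0) {y : ℝ} (hy : 0 < y) :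
    ∃ D, 0 ≤ D ∧ ∀ t : ℝ, y ≤ t →
      ‖wTheta M B k (I * t)‖ ≤ D * Real.exp (-(Real.pi / M) * (t - y)) := by
  have hC : 0 ≤ C := (norm_nonneg _).trans (hB 0)
  refine ⟨∑' m : ℤ, C * (|node M m| ^ k * Real.exp (-Real.pi * y * node M m ^ 2)),
    tsum_nonneg fun m => by positivity, fun t ht => ?_⟩
  rw [← tsum_mul_right]
  refine tsum_of_norm_bounded
    ((((summable_node_bound M k hy).mul_left C).mul_right _).hasSum) fun m => ?_
  by_cases hm : m = 0
  · subst hm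
    have : ((node M 0 : ℝ) : ℂ) = 0 := by simp [node]
    rw [this, h0, zero_mul, norm_zero]
    positivity
  · refine (norm_wTheta_term_le hB k (y := t) (by simp) m).trans ?_
    rw [mul_assoc C]
    exact mul_le_mul_of_nonneg_left (node_bound_decay k ht hm) hC

theorem tendsto_exp_decay {b : ℝ} (hb : 0 < b) (y : ℝ) (p : ℝ) :
    Tendsto (fun t : ℝ => t ^ p * Real.exp (-b * (t - y))) atTop (𝓝 0) := by
  have h := (tendsto_rpow_mul_exp_neg_mul_atTop_nhds_zero p b hb).mul_const (Real.exp (b * y))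
  rw [zero_mul] at h
  refine h.congr fun t => ?_
  rw [mul_assoc, ← Real.exp_add]
  congr 2
  ring

theorem integrableOn_exp_decay {b : ℝ} (hb : 0 < b) (y a : ℝ) :
    IntegrableOn (fun t : ℝ => Real.exp (-b * (t - y))) (Ioi a) := by
  refine IntegrableOn.congr_fun ((exp_neg_integrableOn_Ioi a hb).mul_const (Real.exp (b * y)))
    (fun t _ => ?_) measurableSet_Ioi
  rw [← Real.exp_add]
  congr 1
  ring

theorem tendsto_wTheta_axis_atTop {M : ℕ} [NeZero M] {B : ℤ → ℂ} {C : ℝ} (hB : ∀ m, ‖B m‖ ≤ C)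
    (k : ℕ) (h0 : B 0 * (0 : ℂ) ^ k = 0) (p : ℝ) :
    Tendsto (fun t : ℝ => t ^ p * ‖wTheta M B k (I * t)‖) atTop (𝓝 0) := by
  obtain ⟨D, -, hD⟩ := norm_wTheta_axis_le (M := M) hB k h0 one_pos
  have hM : 0 < Real.pi / (M : ℝ) :=
    div_pos Real.pi_pos (by exact_mod_cast Nat.pos_of_ne_zero (NeZero.ne M))
  have h := (tendsto_exp_decay hM 1 p).const_mul D
  rw [mul_zero] at h
  refine squeeze_zero' ?_ ?_ h
  · filter_upwards [eventually_ge_atTop 0] with t ht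
    positivity
  · filter_upwards [eventually_ge_atTop 1] with t ht
    rw [mul_left_comm]
    exact mul_le_mul_of_nonneg_left (hD t ht) (by positivity)

theorem integrableOn_wTheta_axis {M : ℕ} [NeZero M] {B : ℤ → ℂ} {C : ℝ} (hB : ∀ m, ‖B m‖ ≤ C)
    (k : ℕ) (h0 : B 0 * (0 : ℂ) ^ k = 0) {y : ℝ} (hy : 0 < y) :
    IntegrableOn (fun t : ℝ => wTheta M B k (I * t)) (Ioi y) := by
  obtain ⟨D, -, hD⟩ := norm_wTheta_axis_le (M := M) hB k h0 hy
  have hM : 0 < Real.pi / (M : ℝ) :=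
    div_pos Real.pi_pos (by exact_mod_cast Nat.pos_of_ne_zero (NeZero.ne M))
  refine Integrable.mono' ((integrableOn_exp_decay hM y y).const_mul D) ?_ ?_
  · exact ((continuousOn_wTheta_axis hB k).mono (Ioi_subset_Ioi hy.le)).aestronglyMeasurable
      measurableSet_Ioi
  · filter_upwards [ae_restrict_mem measurableSet_Ioi] with t ht using hD t (le_of_lt ht)

theorem norm_sign_mul_le {M : ℕ} {B : ℤ → ℂ} {C : ℝ} (hB : ∀ m, ‖B m‖ ≤ C) (m : ℤ) :
    ‖(Real.sign (node M m) : ℂ) * B m‖ ≤ C := by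
  rw [norm_mul]
  refine (mul_le_of_le_one_left (norm_nonneg _) ?_).trans (hB m)
  rcases Real.sign_apply_eq (node M m) with h | h | h <;> rw [h] <;> simp

/-- The principal branch of `z^{-1/2}`. -/
noncomputable def invSqrt (z : ℂ) : ℂ := (z ^ (1 / 2 : ℂ))⁻¹

theorem sq_cpow_half (z : ℂ) : z ^ (1 / 2 : ℂ) * z ^ (1 / 2 : ℂ) = z := by
  rw [← sq, ← cpow_nat_mul]
  norm_num

theorem cpow_half_eq (z : ℂ) : z ^ (1 / 2 : ℂ) = z * invSqrt z := by
  rcases eq_or_ne z 0 with rfl | hz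
  · simp
  · have h := sq_cpow_half z
    have h0 : z ^ (1 / 2 : ℂ) ≠ 0 := fun h0 => hz (by rw [← h, h0, zero_mul])
    rw [invSqrt, eq_mul_inv_iff_mul_eq₀ h0, h]

theorem norm_invSqrt (z : ℂ) : ‖invSqrt z‖ = (‖z‖ ^ (1 / 2 : ℝ))⁻¹ := by
  have : (1 / 2 : ℂ) = ((1 / 2 : ℝ) : ℂ) := by push_cast; rfl
  rw [invSqrt, norm_inv, this, norm_cpow_real]

theorem norm_invSqrt_le {z : ℂ} {δ : ℝ} (hδ : 0 < δ) (hz : δ ≤ ‖z‖) :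
    ‖invSqrt z‖ ≤ (δ ^ (1 / 2 : ℝ))⁻¹ := by
  rw [norm_invSqrt]
  gcongr

theorem hasDerivAt_cpow_half {z : ℂ} (hz : z ∈ slitPlane) :
    HasDerivAt (fun z : ℂ => z ^ (1 / 2 : ℂ)) (1 / 2 * invSqrt z) z := by
  refine ((hasDerivAt_id z).cpow_const (c := 1 / 2) hz).congr_deriv ?_
  have h0 := slitPlane_ne_zero hz
  simp only [id]
  rw [cpow_sub _ _ h0, cpow_one, cpow_half_eq]
  field_simp

theorem cpow_half_ne_zero {z : ℂ} (hz : z ≠ 0) : z ^ (1 / 2 : ℂ) ≠ 0 := fun h0 =>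
  hz (by rw [← sq_cpow_half z, h0, zero_mul])

theorem hasDerivAt_invSqrt {z : ℂ} (hz : z ∈ slitPlane) :
    HasDerivAt invSqrt (-(1 / 2) * invSqrt z / z) z := by
  have h0 := slitPlane_ne_zero hz
  refine ((hasDerivAt_cpow_half hz).inv (cpow_half_ne_zero h0)).congr_deriv ?_
  rw [sq, sq_cpow_half]
  ring

theorem ofReal_add_mem_slitPlane {z : ℂ} (hz : z ∈ slitPlane) {s : ℝ} (hs : 0 ≤ s) :
    (s + z : ℂ) ∈ slitPlane := by
  rw [mem_slitPlane_iff] at hz ⊢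
  rcases hz with h | h
  · left; simp; linarith
  · right; simpa using h

theorem neg_ofReal_notMem_slitPlane {s : ℝ} (hs : 0 ≤ s) : (-(s : ℂ)) ∉ slitPlane := by
  rw [mem_slitPlane_iff]
  simp [hs]

/-- Near a point of the slit plane, translates by non-negative reals stay away from `0`. -/
theorem exists_ball_slitPlane {c : ℂ} (hc : c ∈ slitPlane) :
    ∃ δ, 0 < δ ∧ ∀ z ∈ Metric.ball c δ, z ∈ slitPlane ∧ ∀ s : ℝ, 0 ≤ s → δ ≤ ‖(s + z : ℂ)‖ := by
  obtain ⟨ε, hε, h⟩ := Metric.isOpen_iff.1 isOpen_slitPlane c hc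
  refine ⟨ε / 2, by positivity, fun z hz => ⟨h (Metric.ball_subset_ball (by linarith) hz),
    fun s hs => ?_⟩⟩
  by_contra! hlt
  refine neg_ofReal_notMem_slitPlane hs (h ?_)
  rw [Metric.mem_ball] at hz ⊢
  have h1 : dist (-(s : ℂ)) z < ε / 2 := by
    rwa [dist_eq_norm, ← norm_neg, show -(-(s : ℂ) - z) = s + z by ring]
  linarith [dist_triangle (-(s : ℂ)) z c]

theorem continuousOn_invSqrt_add {c : ℂ} (hc : c ∈ slitPlane) :
    ContinuousOn (fun s : ℝ => invSqrt (s + c)) (Ici 0) := fun s hs => by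
  have h := (hasDerivAt_invSqrt (ofReal_add_mem_slitPlane hc hs)).continuousAt
  have h2 : ContinuousAt (fun s : ℝ => (s + c : ℂ)) s := by fun_prop
  exact (ContinuousAt.comp (f := fun s : ℝ => (s + c : ℂ)) h h2).continuousWithinAt

theorem integrableOn_mul_invSqrt {f : ℝ → ℂ} {c : ℂ} (hc : c ∈ slitPlane) {a : ℝ} (ha : 0 ≤ a)
    (hf : IntegrableOn f (Ioi a)) : IntegrableOn (fun s : ℝ => f s * invSqrt (s + c)) (Ioi a) := by
  obtain ⟨δ, hδ, h⟩ := exists_ball_slitPlane hc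
  refine Integrable.mul_bdd (c := (δ ^ (1 / 2 : ℝ))⁻¹) hf ?_ ?_
  · exact ((continuousOn_invSqrt_add hc).mono fun s hs => ha.trans (le_of_lt hs)).aestronglyMeasurable
      measurableSet_Ioi
  · filter_upwards [ae_restrict_mem measurableSet_Ioi] with s hs
    exact norm_invSqrt_le hδ ((h c (Metric.mem_ball_self hδ)).2 s (ha.trans (le_of_lt hs)))

/-- Differentiation of `c ↦ ∫_0^∞ f(s) (s + c)^{-1/2} ds`, followed by an integration by parts. -/
theorem hasDerivAt_integral_invSqrt {f f' : ℝ → ℂ} {f0 : ℂ}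
    (hd : ∀ s ∈ Ioi (0 : ℝ), HasDerivAt f (f' s) s) (hf : IntegrableOn f (Ioi 0))
    (hf' : IntegrableOn f' (Ioi 0)) (h0 : Tendsto f (𝓝[>] 0) (𝓝 f0))
    (htop : Tendsto f atTop (𝓝 0)) {c : ℂ} (hc : c ∈ slitPlane) :
    HasDerivAt (fun c : ℂ => ∫ s in Ioi (0 : ℝ), f s * invSqrt (s + c))
      (-f0 * invSqrt c - ∫ s in Ioi (0 : ℝ), f' s * invSqrt (s + c)) c := by
  obtain ⟨δ, hδ, hball⟩ := exists_ball_slitPlane hc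
  have hcb := Metric.mem_ball_self (x := c) hδ
  have hk : ContinuousOn (fun s : ℝ => -(1 / 2) * invSqrt (s + c) / (s + c)) (Ici 0) := by
    refine ((continuousOn_invSqrt_add hc).const_mul _).div (by fun_prop) fun s hs => ?_
    exact slitPlane_ne_zero (ofReal_add_mem_slitPlane hc hs)
  have hbd : ∀ s : ℝ, 0 ≤ s → ∀ z ∈ Metric.ball c δ,
      ‖-(1 / 2) * invSqrt (s + z) / (s + z)‖ ≤ (δ ^ (1 / 2 : ℝ))⁻¹ / δ := by
    intro s hs z hz
    have h1 := (hball z hz).2 s hs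
    rw [norm_div, norm_mul]
    have h2 := norm_invSqrt_le hδ h1
    have h3 : ‖(-(1 / 2) : ℂ)‖ ≤ 1 := by norm_num
    calc _ ≤ 1 * (δ ^ (1 / 2 : ℝ))⁻¹ / δ := by gcongr
      _ = _ := by rw [one_mul]
  have hmeas : ∀ z ∈ Metric.ball c δ,
      AEStronglyMeasurable (fun s : ℝ => f s * invSqrt (s + z)) (volume.restrict (Ioi 0)) :=
    fun z hz => (integrableOn_mul_invSqrt (hball z hz).1 le_rfl hf).aestronglyMeasurable
  have hint : IntegrableOn (fun s : ℝ => f s * (-(1 / 2) * invSqrt (s + c) / (s + c))) (Ioi 0) := by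
    refine Integrable.mul_bdd (c := (δ ^ (1 / 2 : ℝ))⁻¹ / δ) hf ?_ ?_
    · exact (hk.mono Ioi_subset_Ici_self).aestronglyMeasurable measurableSet_Ioi
    · filter_upwards [ae_restrict_mem measurableSet_Ioi] with s hs
      exact hbd s (le_of_lt hs) c hcb
  have key := (hasDerivAt_integral_of_dominated_loc_of_deriv_le (μ := volume.restrict (Ioi (0 : ℝ)))
    (F := fun (z : ℂ) (s : ℝ) => f s * invSqrt (s + z))
    (F' := fun (z : ℂ) (s : ℝ) => f s * (-(1 / 2) * invSqrt (s + z) / (s + z)))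
    (bound := fun s => ‖f s‖ * ((δ ^ (1 / 2 : ℝ))⁻¹ / δ))
    (Metric.ball_mem_nhds c hδ)
    (by filter_upwards [Metric.ball_mem_nhds c hδ] with z hz using hmeas z hz)
    (integrableOn_mul_invSqrt hc le_rfl hf) hint.aestronglyMeasurable ?_
    (hf.norm.mul_const _) ?_).2
  · refine key.congr_deriv ?_
    have hdk : ∀ s ∈ Ioi (0 : ℝ), HasDerivAt (fun s : ℝ => invSqrt (s + c))
        (-(1 / 2) * invSqrt (s + c) / (s + c)) s := fun s hs => by
      have h1 : HasDerivAt (fun s : ℝ => (s + c : ℂ)) 1 s :=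
        ((hasDerivAt_id s).ofReal_comp).add_const c
      have h2 := HasDerivAt.comp s
        (hasDerivAt_invSqrt (ofReal_add_mem_slitPlane hc (le_of_lt hs))) h1
      exact h2.congr_deriv (mul_one _)
    rw [integral_Ioi_mul_deriv_eq_deriv_mul hd hdk hint (integrableOn_mul_invSqrt hc le_rfl hf')
      (a' := f0 * invSqrt c) (b' := 0)]
    · ring
    · refine h0.mul ?_
      have h1 : ContinuousAt (fun s : ℝ => invSqrt (s + c)) 0 := by
        have h := (hasDerivAt_invSqrt (ofReal_add_mem_slitPlane hc le_rfl)).continuousAt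
        have h2 : ContinuousAt (fun s : ℝ => (s + c : ℂ)) 0 := by fun_prop
        exact ContinuousAt.comp (f := fun s : ℝ => (s + c : ℂ)) h h2
      have h2 := h1.tendsto
      simp only [ofReal_zero, zero_add] at h2
      exact h2.mono_left nhdsWithin_le_nhds
    · refine htop.zero_mul_isBoundedUnder_le ?_
      refine isBoundedUnder_of_eventually_le (a := (δ ^ (1 / 2 : ℝ))⁻¹) ?_
      filter_upwards [eventually_ge_atTop 0] with s hs
      exact norm_invSqrt_le hδ ((hball c hcb).2 s hs)
  · filter_upwards [ae_restrict_mem measurableSet_Ioi] with s hs z hz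
    rw [norm_mul]
    exact mul_le_mul_of_nonneg_left (hbd s (le_of_lt hs) z hz) (norm_nonneg _)
  · filter_upwards [ae_restrict_mem measurableSet_Ioi] with s hs z hz
    have h1 : HasDerivAt (fun z : ℂ => (s + z : ℂ)) 1 z := (hasDerivAt_id z).const_add _
    have h2 := HasDerivAt.comp z
      (hasDerivAt_invSqrt (ofReal_add_mem_slitPlane (hball z hz).1 (le_of_lt hs))) h1
    exact (h2.congr_deriv (mul_one _)).const_mul (f s)

/-- Differentiation under the integral sign over `[0, 1]`, for a jointly continuous derivative. -/
theorem hasDerivAt_integral_unitInterval {U : Set ℂ} (hU : IsOpen U) {F F' : ℂ → ℝ → ℂ}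
    (hF : ContinuousOn (Function.uncurry F) (U ×ˢ Icc 0 1))
    (hF' : ContinuousOn (Function.uncurry F') (U ×ˢ Icc 0 1))
    (hd : ∀ z ∈ U, ∀ u ∈ Icc (0 : ℝ) 1, HasDerivAt (fun z => F z u) (F' z u) z)
    {z₀ : ℂ} (hz₀ : z₀ ∈ U) :
    HasDerivAt (fun z => ∫ u in (0 : ℝ)..1, F z u) (∫ u in (0 : ℝ)..1, F' z₀ u) z₀ := by
  obtain ⟨δ, hδ, hsub⟩ := Metric.nhds_basis_closedBall.mem_iff.1 (hU.mem_nhds hz₀)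
  have hcomp : IsCompact (Metric.closedBall z₀ δ ×ˢ Icc (0 : ℝ) 1) :=
    (isCompact_closedBall z₀ δ).prod isCompact_Icc
  obtain ⟨K, hK⟩ := hcomp.exists_bound_of_continuousOn
    (hF'.mono (prod_mono hsub subset_rfl))
  have hsec : ∀ {G : ℂ → ℝ → ℂ}, ContinuousOn (Function.uncurry G) (U ×ˢ Icc 0 1) →
      ∀ z ∈ U, ContinuousOn (G z) (Icc 0 1) := fun {G} hG z hz =>
    hG.comp (f := fun u : ℝ => (z, u)) (by fun_prop) fun u hu => ⟨hz, hu⟩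
  have hIoc : uIoc (0 : ℝ) 1 = Ioc 0 1 := uIoc_of_le zero_le_one
  have hm : ∀ {G : ℂ → ℝ → ℂ}, ContinuousOn (Function.uncurry G) (U ×ˢ Icc 0 1) →
      ∀ z ∈ U, AEStronglyMeasurable (G z) (volume.restrict (uIoc 0 1)) := fun {G} hG z hz => by
    rw [hIoc]
    exact ((hsec hG z hz).mono Ioc_subset_Icc_self).aestronglyMeasurable measurableSet_Ioc
  refine (intervalIntegral.hasDerivAt_integral_of_dominated_loc_of_deriv_le
    (bound := fun _ => K) (Metric.ball_mem_nhds z₀ hδ)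
    ?_ ?_ (hm hF' z₀ hz₀) ?_ (by simp) ?_).2
  · filter_upwards [hU.mem_nhds hz₀] with z hz using hm hF z hz
  · exact (hsec hF z₀ hz₀).intervalIntegrable_of_Icc zero_le_one
  · refine Eventually.of_forall fun u hu z hz => ?_
    rw [hIoc] at hu
    exact hK (z, u) ⟨Metric.ball_subset_closedBall hz, Ioc_subset_Icc_self hu⟩
  · refine Eventually.of_forall fun u hu z hz => ?_
    rw [hIoc] at hu
    exact hd z (hsub (Metric.ball_subset_closedBall hz)) u (Ioc_subset_Icc_self hu)

theorem hasDerivAt_cexp_mul_ofReal (b : ℂ) (s : ℝ) :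
    HasDerivAt (fun s : ℝ => exp (b * s)) (b * exp (b * s)) s := by
  have h : HasDerivAt (fun s : ℝ => b * (s : ℂ)) (b * 1) s :=
    (hasDerivAt_id s).ofReal_comp.const_mul b
  exact h.cexp.congr_deriv (by ring)

theorem tendsto_cexp_neg_mul_atTop {α : ℝ} (hα : 0 < α) :
    Tendsto (fun s : ℝ => exp (-(α : ℂ) * s)) atTop (𝓝 0) := by
  rw [tendsto_zero_iff_norm_tendsto_zero]
  have h := tendsto_exp_decay hα 0 0
  refine h.congr fun t => ?_
  rw [norm_exp]
  simp

theorem integrableOn_cexp_neg_mul {α : ℝ} (hα : 0 < α) (a : ℝ) :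
    IntegrableOn (fun s : ℝ => exp (-(α : ℂ) * s)) (Ioi a) :=
  integrableOn_exp_mul_complex_Ioi (by simpa using hα) a

theorem hasDerivAt_laplace_invSqrt {α : ℝ} (hα : 0 < α) {c : ℂ} (hc : c ∈ slitPlane) :
    HasDerivAt (fun c : ℂ => ∫ s in Ioi (0 : ℝ), exp (-(α : ℂ) * s) * invSqrt (s + c))
      (-invSqrt c + α * ∫ s in Ioi (0 : ℝ), exp (-(α : ℂ) * s) * invSqrt (s + c)) c := by
  have h := hasDerivAt_integral_invSqrt (f := fun s : ℝ => exp (-(α : ℂ) * s)) (f0 := 1)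
    (fun s _ => hasDerivAt_cexp_mul_ofReal _ s) (integrableOn_cexp_neg_mul hα 0)
    ((integrableOn_cexp_neg_mul hα 0).const_mul _) ?_ (tendsto_cexp_neg_mul_atTop hα) hc
  · refine h.congr_deriv ?_
    simp only [mul_assoc]
    rw [integral_const_mul]
    ring
  · have : ContinuousAt (fun s : ℝ => exp (-(α : ℂ) * s)) 0 := by fun_prop
    have h2 := this.tendsto
    simp only [ofReal_zero, mul_zero, exp_zero] at h2
    exact h2.mono_left nhdsWithin_le_nhds

theorem hasDerivAt_gaussian_unitInterval (α c : ℂ) :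
    HasDerivAt (fun c : ℂ => ∫ u in (0 : ℝ)..1, exp (-α * (u : ℂ) ^ 2 * c))
      (∫ u in (0 : ℝ)..1, -α * (u : ℂ) ^ 2 * exp (-α * (u : ℂ) ^ 2 * c)) c := by
  refine hasDerivAt_integral_unitInterval isOpen_univ
    (F := fun c u => exp (-α * (u : ℂ) ^ 2 * c))
    (F' := fun c u => -α * (u : ℂ) ^ 2 * exp (-α * (u : ℂ) ^ 2 * c)) ?_ ?_ ?_ (mem_univ c)
  · exact Continuous.continuousOn (by simp only [Function.uncurry_def]; fun_prop)
  · exact Continuous.continuousOn (by simp only [Function.uncurry_def]; fun_prop)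
  · intro z _ u _
    have h : HasDerivAt (fun z : ℂ => -α * (u : ℂ) ^ 2 * z) (-α * (u : ℂ) ^ 2 * 1) z :=
      (hasDerivAt_id z).const_mul _
    exact h.cexp.congr_deriv (by ring)

theorem integral_gaussian_unitInterval_parts (α c : ℂ) :
    (∫ u in (0 : ℝ)..1, exp (-α * (u : ℂ) ^ 2 * c)) +
      2 * c * (∫ u in (0 : ℝ)..1, -α * (u : ℂ) ^ 2 * exp (-α * (u : ℂ) ^ 2 * c)) =
        exp (-α * c) := by
  rw [← intervalIntegral.integral_const_mul, ← intervalIntegral.integral_add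
    (Continuous.intervalIntegrable (by fun_prop) _ _)
    (Continuous.intervalIntegrable (by fun_prop) _ _)]
  rw [intervalIntegral.integral_eq_sub_of_hasDerivAt
    (f := fun u : ℝ => (u : ℂ) * exp (-α * (u : ℂ) ^ 2 * c))]
  · simp
  · intro u _
    have h1 : HasDerivAt (fun u : ℝ => (u : ℂ)) 1 u := (hasDerivAt_id u).ofReal_comp
    have h2 := h1.mul (((h1.pow 2).const_mul (-α)).mul_const c).cexp
    refine h2.congr_deriv ?_
    simp only [Pi.pow_apply]
    push_cast
    ring
  · exact Continuous.intervalIntegrable (by fun_prop) _ _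

theorem hasDerivAt_sqrt_mul_gaussian (α : ℂ) {c : ℂ} (hc : c ∈ slitPlane) :
    HasDerivAt (fun c : ℂ =>
      2 * c ^ (1 / 2 : ℂ) * ∫ u in (0 : ℝ)..1, exp (-α * (u : ℂ) ^ 2 * c))
      (invSqrt c * exp (-α * c)) c := by
  refine (((hasDerivAt_cpow_half hc).const_mul 2).mul
    (hasDerivAt_gaussian_unitInterval α c)).congr_deriv ?_
  rw [← integral_gaussian_unitInterval_parts α c, cpow_half_eq]
  ring

theorem tendsto_laplace_invSqrt {α : ℝ} (hα : 0 < α) :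
    Tendsto (fun R : ℝ => exp (-(α : ℂ) * R) *
      ∫ s in Ioi (0 : ℝ), exp (-(α : ℂ) * s) * invSqrt (s + (R : ℂ))) atTop (𝓝 0) := by
  refine (tendsto_cexp_neg_mul_atTop hα).zero_mul_isBoundedUnder_le ?_
  refine isBoundedUnder_of_eventually_le (a := ∫ s in Ioi (0 : ℝ), Real.exp (-α * s)) ?_
  filter_upwards [eventually_ge_atTop 1] with R hR
  refine norm_integral_le_of_norm_le (exp_neg_integrableOn_Ioi 0 hα) ?_
  filter_upwards [ae_restrict_mem measurableSet_Ioi] with s hs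
  have h1 : ‖exp (-(α : ℂ) * s)‖ = Real.exp (-α * s) := by
    rw [norm_exp]; simp
  have h2 : ‖invSqrt (s + (R : ℂ))‖ ≤ 1 := by
    have hs' : (0 : ℝ) < s := hs
    have := norm_invSqrt_le (z := s + (R : ℂ)) one_pos (by
      rw [← ofReal_add, norm_real, Real.norm_eq_abs]
      exact le_trans (by linarith) (le_abs_self _))
    simpa using this
  rw [norm_mul, h1]
  exact mul_le_of_le_one_right (Real.exp_pos _).le h2

theorem tendsto_sqrt_mul_gaussian {α : ℝ} (hα : 0 < α) :
    Tendsto (fun R : ℝ => 2 * (R : ℂ) ^ (1 / 2 : ℂ) *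
      ∫ u in (0 : ℝ)..1, exp (-(α : ℂ) * (u : ℂ) ^ 2 * R)) atTop (𝓝 (√(Real.pi / α) : ℝ)) := by
  have h := (intervalIntegral_tendsto_integral_Ioi 0
    (integrable_exp_neg_mul_sq hα).integrableOn Real.tendsto_sqrt_atTop).const_mul 2
  rw [integral_gaussian_Ioi, mul_div_cancel₀ _ two_ne_zero] at h
  refine (continuous_ofReal.continuousAt.tendsto.comp h).congr' ?_
  filter_upwards [eventually_ge_atTop 0] with R hR
  have e1 : (R : ℂ) ^ (1 / 2 : ℂ) = (√R : ℝ) := by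
    rw [Real.sqrt_eq_rpow, ofReal_cpow hR]; push_cast; rfl
  have e2 := intervalIntegral.mul_integral_comp_mul_left (a := 0) (b := 1)
    (f := fun x => Real.exp (-α * x ^ 2)) (√R)
  rw [mul_zero, mul_one] at e2
  simp only [Function.comp_apply]
  rw [e1, ← e2, ofReal_mul, ofReal_mul, ← intervalIntegral.integral_ofReal, ofReal_ofNat,
    mul_assoc]
  congr 2
  refine intervalIntegral.integral_congr fun u _ => ?_
  simp only [ofReal_exp]
  congr 1
  rw [mul_pow, Real.sq_sqrt hR]
  push_cast
  ring

/-- The complex error function is complementary to its incomplete integral on the slit plane. -/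
theorem laplace_add_gaussian {α : ℝ} (hα : 0 < α) {c : ℂ} (hc : c ∈ slitPlane) :
    exp (-(α : ℂ) * c) * (∫ s in Ioi (0 : ℝ), exp (-(α : ℂ) * s) * invSqrt (s + c)) +
      2 * c ^ (1 / 2 : ℂ) * (∫ u in (0 : ℝ)..1, exp (-(α : ℂ) * (u : ℂ) ^ 2 * c)) =
        (√(Real.pi / α) : ℝ) := by
  set E : ℂ → ℂ := fun c =>
    exp (-(α : ℂ) * c) * (∫ s in Ioi (0 : ℝ), exp (-(α : ℂ) * s) * invSqrt (s + c)) +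
      2 * c ^ (1 / 2 : ℂ) * (∫ u in (0 : ℝ)..1, exp (-(α : ℂ) * (u : ℂ) ^ 2 * c)) with hE
  have hd : ∀ c ∈ slitPlane, HasDerivAt E 0 c := fun c hc => by
    have h1 : HasDerivAt (fun c : ℂ => -(α : ℂ) * c) (-(α : ℂ) * 1) c :=
      (hasDerivAt_id c).const_mul _
    refine ((h1.cexp.mul (hasDerivAt_laplace_invSqrt hα hc)).add
      (hasDerivAt_sqrt_mul_gaussian α hc)).congr_deriv ?_
    ring
  have hconst : ∀ R : ℝ, 0 < R → E R = E c := fun R hR =>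
    isOpen_slitPlane.is_const_of_deriv_eq_zero
      (starConvex_one_slitPlane.isPathConnected one_mem_slitPlane).isConnected.isPreconnected
      (fun z hz => (hd z hz).differentiableAt.differentiableWithinAt)
      (fun z hz => (hd z hz).deriv) (ofReal_mem_slitPlane.2 hR) hc
  have hlim := (tendsto_laplace_invSqrt hα).add (tendsto_sqrt_mul_gaussian hα)
  rw [zero_add] at hlim
  refine tendsto_nhds_unique (f := fun _ : ℝ => E c) (l := atTop) tendsto_const_nhds ?_
  refine hlim.congr' ?_
  filter_upwards [eventually_gt_atTop 0] with R hR using hconst R hR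

/-- The integral of `θ_k` over the segment from `τ` to `i`, in the parametrisation
`z = τ + u² (i - τ)` which removes the singularity of `(z - τ)^{-1/2}`. -/
noncomputable def segIntegral (M : ℕ) (B : ℤ → ℂ) (k : ℕ) (τ : ℂ) : ℂ :=
  ∫ u in (0 : ℝ)..1, wTheta M B k (τ + (u : ℂ) ^ 2 * (I - τ))

theorem im_segment (τ : ℂ) (u : ℝ) :
    (τ + (u : ℂ) ^ 2 * (I - τ)).im = (1 - u ^ 2) * τ.im + u ^ 2 := by
  have : τ + (u : ℂ) ^ 2 * (I - τ) = τ + ((u ^ 2 : ℝ) : ℂ) * (I - τ) := by push_cast; rfl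
  rw [this, add_im, im_ofReal_mul, sub_im, I_im]
  ring

theorem min_le_im_segment (τ : ℂ) {u : ℝ} (hu : u ∈ Icc (0 : ℝ) 1) :
    min τ.im 1 ≤ (τ + (u : ℂ) ^ 2 * (I - τ)).im := by
  rw [im_segment]
  have h1 : u ^ 2 ≤ 1 := by nlinarith [hu.1, hu.2]
  have h2 := min_le_left τ.im 1
  have h3 := min_le_right τ.im 1
  nlinarith [sq_nonneg u]

theorem im_segment_pos {τ : ℂ} (hτ : 0 < τ.im) {u : ℝ} (hu : u ∈ Icc (0 : ℝ) 1) :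
    0 < (τ + (u : ℂ) ^ 2 * (I - τ)).im :=
  (lt_min hτ one_pos).trans_le (min_le_im_segment τ hu)

theorem setIntegral_Ioi_one (g : ℝ → ℂ) :
    ∫ t in Ioi (1 : ℝ), g t = ∫ s in Ioi (0 : ℝ), g (s + 1) := by
  have h := (measurePreserving_add_right (volume : Measure ℝ) 1).setIntegral_preimage_emb
    (measurableEmbedding_addRight 1) g (Ioi 1)
  rw [← h]
  congr 2
  ext s
  simp

/-- `sgn(x) e^{πi x² w}` as an integral over the path consisting of the segment from `w` to `i`
and the half-line from `i` to `i∞`. -/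
theorem sign_mul_cexp_eq {w : ℂ} (hw : 1 + I * w ∈ slitPlane) (x : ℝ) :
    x * (∫ t in Ioi (1 : ℝ), exp (Real.pi * I * (I * t) * (x : ℂ) ^ 2) * invSqrt (t + I * w)) +
      2 * (1 + I * w) ^ (1 / 2 : ℂ) * (x *
        ∫ u in (0 : ℝ)..1, exp (Real.pi * I * (w + (u : ℂ) ^ 2 * (I - w)) * (x : ℂ) ^ 2)) =
      (Real.sign x : ℂ) * exp (Real.pi * I * w * (x : ℂ) ^ 2) := by
  rcases eq_or_ne x 0 with rfl | hx
  · simp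
  set α : ℝ := Real.pi * x ^ 2 with hα
  have hα0 : 0 < α := by positivity
  have h := laplace_add_gaussian hα0 hw
  have e1 : ∫ t in Ioi (1 : ℝ), exp (Real.pi * I * (I * t) * (x : ℂ) ^ 2) * invSqrt (t + I * w) =
      exp (-(α : ℂ)) * ∫ s in Ioi (0 : ℝ), exp (-(α : ℂ) * s) * invSqrt (s + (1 + I * w)) := by
    rw [setIntegral_Ioi_one, ← integral_const_mul]
    congr 1
    ext s
    rw [← mul_assoc (exp (-(α : ℂ))), ← exp_add]
    congr 2
    · rw [hα]
      push_cast
      linear_combination (Real.pi : ℂ) * (s + 1) * x ^ 2 * I_sq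
    · push_cast; ring
  have e2 : ∫ u in (0 : ℝ)..1, exp (Real.pi * I * (w + (u : ℂ) ^ 2 * (I - w)) * (x : ℂ) ^ 2) =
      exp (Real.pi * I * w * (x : ℂ) ^ 2) *
        ∫ u in (0 : ℝ)..1, exp (-(α : ℂ) * (u : ℂ) ^ 2 * (1 + I * w)) := by
    rw [← intervalIntegral.integral_const_mul]
    congr 1
    ext u
    rw [← exp_add]
    congr 1
    rw [hα]
    push_cast
    linear_combination (Real.pi : ℂ) * u ^ 2 * x ^ 2 * I_sq
  have e3 : exp (-(α : ℂ)) =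
      exp (Real.pi * I * w * (x : ℂ) ^ 2) * exp (-(α : ℂ) * (1 + I * w)) := by
    rw [← exp_add]
    congr 1
    rw [hα]
    push_cast
    ring
  have e4 : x * √(Real.pi / α) = Real.sign x := by
    have : Real.pi / α = (|x|⁻¹) ^ 2 := by
      rw [hα, inv_pow, sq_abs]
      field_simp
    rw [this, Real.sqrt_sq (by positivity)]
    rcases lt_or_gt_of_ne hx with h | h
    · rw [Real.sign_of_neg h, abs_of_neg h]; field_simp
    · rw [Real.sign_of_pos h, abs_of_pos h]; field_simp
  have e4' : (x : ℂ) * (√(Real.pi / α) : ℝ) = (Real.sign x : ℂ) := by exact_mod_cast e4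
  rw [e1, e2, e3, ← e4', ← h]
  ring

theorem add_I_mul_mem_slitPlane {w : ℂ} (hw : 1 + I * w ∈ slitPlane) {t : ℝ} (ht : 1 ≤ t) :
    (t : ℂ) + I * w ∈ slitPlane := by
  have h := ofReal_add_mem_slitPlane hw (sub_nonneg.2 ht)
  convert h using 1
  push_cast
  ring

theorem hasSum_halfLine {M : ℕ} [NeZero M] {B : ℤ → ℂ} {C : ℝ} (hB : ∀ m, ‖B m‖ ≤ C) (k : ℕ)
    {w : ℂ} (hw : 1 + I * w ∈ slitPlane) :
    HasSum (fun m : ℤ => B m * (node M m : ℂ) ^ (k + 1) * ∫ t in Ioi (1 : ℝ),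
        exp (Real.pi * I * (I * t) * (node M m : ℂ) ^ 2) * invSqrt (t + I * w))
      (∫ t in Ioi (1 : ℝ), wTheta M B (k + 1) (I * t) * invSqrt (t + I * w)) := by
  have hC : 0 ≤ C := (norm_nonneg _).trans (hB 0)
  have hM : 0 < Real.pi / (M : ℝ) :=
    div_pos Real.pi_pos (by exact_mod_cast Nat.pos_of_ne_zero (NeZero.ne M))
  obtain ⟨δ, hδ, hball⟩ := exists_ball_slitPlane hw
  set K : ℝ := (δ ^ (1 / 2 : ℝ))⁻¹ with hK
  have hK0 : 0 ≤ K := by positivity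
  have hker : ∀ t : ℝ, 1 ≤ t → ‖invSqrt (t + I * w)‖ ≤ K := fun t ht => by
    refine norm_invSqrt_le hδ ?_
    have := (hball _ (Metric.mem_ball_self hδ)).2 (t - 1) (sub_nonneg.2 ht)
    convert this using 2
    push_cast
    ring
  have hcont : ContinuousOn (fun t : ℝ => invSqrt (t + I * w)) (Ioi 1) := fun t ht => by
    have h := (hasDerivAt_invSqrt (add_I_mul_mem_slitPlane hw (le_of_lt ht))).continuousAt
    have h2 : ContinuousAt (fun s : ℝ => (s + I * w : ℂ)) t := by fun_prop
    exact (ContinuousAt.comp (f := fun s : ℝ => (s + I * w : ℂ)) h h2).continuousWithinAt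
  set F : ℤ → ℝ → ℂ := fun m t => B m * (node M m : ℂ) ^ (k + 1) *
    exp (Real.pi * I * (I * t) * (node M m : ℂ) ^ 2) * invSqrt (t + I * w) with hF
  obtain ⟨u, hu⟩ : ∃ u : ℤ → ℝ, ∀ m, u m =
    C * (|node M m| ^ (k + 1) * Real.exp (-Real.pi * 1 * node M m ^ 2)) := ⟨_, fun _ => rfl⟩
  have hu0 : ∀ m, 0 ≤ u m := fun m => by rw [hu]; positivity
  have husum : Summable u := by
    simp only [funext hu]
    exact (summable_node_bound M (k + 1) one_pos).mul_left C
  have hbound : ∀ m, ∀ t ∈ Ioi (1 : ℝ),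
      ‖F m t‖ ≤ u m * (Real.exp (-(Real.pi / M) * (t - 1)) * K) := by
    intro m t ht
    by_cases hm : m = 0
    · have h0 : ((node M 0 : ℝ) : ℂ) = 0 := by simp [node]
      have : F m t = 0 := by simp [hF, hm, h0]
      rw [this, norm_zero]
      exact mul_nonneg (hu0 m) (by positivity)
    · rw [hF]
      simp only
      rw [norm_mul, ← mul_assoc (u m)]
      refine mul_le_mul ?_ (hker t (le_of_lt ht)) (norm_nonneg _)
        (mul_nonneg (hu0 m) (Real.exp_pos _).le)
      refine (norm_wTheta_term_le hB (k + 1) (y := t) (by simp) m).trans ?_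
      rw [hu, mul_assoc C]
      exact mul_le_mul_of_nonneg_left (node_bound_decay (k + 1) (le_of_lt ht) hm) hC
  have hgint : IntegrableOn (fun t : ℝ => Real.exp (-(Real.pi / M) * (t - 1)) * K) (Ioi 1) :=
    (integrableOn_exp_decay hM 1 1).mul_const K
  have hFint : ∀ m, Integrable (F m) (volume.restrict (Ioi 1)) := fun m => by
    refine Integrable.mono' (hgint.const_mul (u m)) ?_ ?_
    · refine ContinuousOn.aestronglyMeasurable ?_ measurableSet_Ioi
      exact (Continuous.continuousOn (by fun_prop)).mul hcont
    · filter_upwards [ae_restrict_mem measurableSet_Ioi] with t ht using hbound m t ht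
  have key := hasSum_integral_of_summable_integral_norm hFint ?_
  · have e : (∫ t in Ioi (1 : ℝ), wTheta M B (k + 1) (I * t) * invSqrt (t + I * w)) =
        ∫ t in Ioi (1 : ℝ), ∑' m, F m t := by
      refine setIntegral_congr_fun measurableSet_Ioi fun t _ => ?_
      simp only [hF]
      rw [tsum_mul_right, wTheta]
    rw [e]
    refine key.congr_fun fun m => ?_
    rw [hF, ← integral_const_mul]
    simp only [mul_assoc]
  · refine Summable.of_nonneg_of_le (fun m => integral_nonneg fun t => norm_nonneg _) (fun m => ?_)
      (husum.mul_right (∫ t in Ioi (1 : ℝ), Real.exp (-(Real.pi / M) * (t - 1)) * K))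
    rw [← integral_const_mul]
    exact setIntegral_mono_on (hFint m).norm (hgint.const_mul _) measurableSet_Ioi
      fun t ht => hbound m t ht

theorem hasSum_segIntegral {M : ℕ} [NeZero M] {B : ℤ → ℂ} {C : ℝ} (hB : ∀ m, ‖B m‖ ≤ C) (k : ℕ)
    {w : ℂ} (hw : 0 < w.im) :
    HasSum (fun m : ℤ => B m * (node M m : ℂ) ^ k * ∫ u in (0 : ℝ)..1,
        exp (Real.pi * I * (w + (u : ℂ) ^ 2 * (I - w)) * (node M m : ℂ) ^ 2))
      (segIntegral M B k w) := by
  have hmin : 0 < min w.im 1 := lt_min hw one_pos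
  have hIoc : uIoc (0 : ℝ) 1 = Ioc 0 1 := uIoc_of_le zero_le_one
  have hsum := (summable_node_bound M k hmin).mul_left C
  have key := intervalIntegral.hasSum_integral_of_dominated_convergence (μ := volume)
    (a := 0) (b := 1)
    (F := fun (m : ℤ) (u : ℝ) => B m * (node M m : ℂ) ^ k *
      exp (Real.pi * I * (w + (u : ℂ) ^ 2 * (I - w)) * (node M m : ℂ) ^ 2))
    (f := fun u : ℝ => wTheta M B k (w + (u : ℂ) ^ 2 * (I - w)))
    (fun m _ => C * (|node M m| ^ k * Real.exp (-Real.pi * (min w.im 1) * node M m ^ 2)))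
    (fun m => (Continuous.aestronglyMeasurable (by fun_prop)))
    (fun m => Eventually.of_forall fun u hu => ?_)
    (Eventually.of_forall fun u _ => hsum) (by simp)
    (Eventually.of_forall fun u hu => ?_)
  · exact key.congr_fun fun m => (intervalIntegral.integral_const_mul _ _).symm
  · rw [hIoc] at hu
    exact norm_wTheta_term_le hB k (min_le_im_segment w (Ioc_subset_Icc_self hu)) m
  · rw [hIoc] at hu
    exact (summable_wTheta (M := M) (B := B) hB k (im_segment_pos hw (Ioc_subset_Icc_self hu))).hasSum

/-- The false theta function as an Eichler-type integral from `w` to `i∞` through `i`. -/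
theorem wTheta_sign_eq {M : ℕ} [NeZero M] {B : ℤ → ℂ} {C : ℝ} (hB : ∀ m, ‖B m‖ ≤ C) (k : ℕ)
    {w : ℂ} (hw : 0 < w.im) (hw' : 1 + I * w ∈ slitPlane) :
    wTheta M (fun m => (Real.sign (node M m) : ℂ) * B m) k w =
      (∫ t in Ioi (1 : ℝ), wTheta M B (k + 1) (I * t) * invSqrt (t + I * w)) +
        2 * (1 + I * w) ^ (1 / 2 : ℂ) * segIntegral M B (k + 1) w := by
  have h := (hasSum_halfLine (M := M) hB k hw').add
    ((hasSum_segIntegral (M := M) hB (k + 1) hw).mul_left (2 * (1 + I * w) ^ (1 / 2 : ℂ)))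
  rw [← h.tsum_eq, wTheta]
  refine tsum_congr fun m => ?_
  have := sign_mul_cexp_eq hw' (node M m)
  linear_combination -(B m * (node M m : ℂ) ^ k) * this

/-- The indicator function of the class of `e` modulo `M`. -/
noncomputable def classInd (M : ℕ) (e m : ℤ) : ℂ := if (M : ℤ) ∣ m - e then 1 else 0

/-- The additive character `m ↦ e^{2πi e m / M}`. -/
noncomputable def classChar (M : ℕ) (e m : ℤ) : ℂ := exp (2 * Real.pi * I * (e * m / M))

theorem ofReal_node_sq (M : ℕ) (m : ℤ) : (node M m : ℂ) ^ 2 = (m : ℂ) ^ 2 / M := by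
  rw [← ofReal_pow, node_sq]
  push_cast
  rfl

theorem ofReal_node (M : ℕ) (m : ℤ) : (node M m : ℂ) = m * (1 / (√(M : ℝ) : ℂ)) := by
  rw [node]
  push_cast
  rfl

theorem wTheta_classInd {M : ℕ} [NeZero M] (e : ℤ) (k : ℕ) (τ : ℂ) :
    wTheta M (classInd M e) k τ =
      ∑' n : ℤ, (node M (e - n * M) : ℂ) ^ k * exp (Real.pi * I * τ * (node M (e - n * M) : ℂ) ^ 2) := by
  have hM : (M : ℤ) ≠ 0 := by exact_mod_cast NeZero.ne M
  have hinj : Function.Injective fun n : ℤ => e - n * M := fun a b h => by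
    have : a * (M : ℤ) = b * M := by simp only at h; linarith
    exact mul_right_cancel₀ hM this
  rw [wTheta, ← hinj.tsum_eq]
  · refine tsum_congr fun n => ?_
    have : (M : ℤ) ∣ e - n * M - e := ⟨-n, by ring⟩
    rw [classInd, if_pos this, one_mul]
  · intro m hm
    by_cases h : (M : ℤ) ∣ m - e
    · obtain ⟨n, hn⟩ := h
      exact ⟨-n, by simp only; linarith⟩
    · exact absurd (by simp [classInd, h]) hm

theorem wTheta_classChar_zero (M : ℕ) (e : ℤ) (τ : ℂ) :
    wTheta M (classChar M e) 0 τ = jacobiTheta₂ (e / M) (τ / M) := by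
  rw [wTheta, jacobiTheta₂]
  refine tsum_congr fun m => ?_
  rw [jacobiTheta₂_term, classChar, pow_zero, mul_one, ← exp_add, ofReal_node_sq]
  congr 1
  ring

theorem wTheta_classChar_one (M : ℕ) (e : ℤ) (τ : ℂ) :
    2 * Real.pi * I * wTheta M (classChar M e) 1 τ =
      1 / (√(M : ℝ) : ℂ) * jacobiTheta₂' (e / M) (τ / M) := by
  rw [wTheta, jacobiTheta₂', ← tsum_mul_left, ← tsum_mul_left]
  refine tsum_congr fun m => ?_
  have : jacobiTheta₂_term m (e / M) (τ / M) =
      classChar M e m * exp (Real.pi * I * τ * (node M m : ℂ) ^ 2) := by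
    rw [jacobiTheta₂_term, classChar, ← exp_add, ofReal_node_sq]
    congr 1
    ring
  rw [jacobiTheta₂'_term, this, pow_one, ofReal_node]
  ring

theorem exp_mul_jacobiTheta₂_term (M : ℕ) [NeZero M] (e n : ℤ) {t : ℝ} (ht : 0 < t) :
    exp (-Real.pi * I * ((e : ℂ) / M) ^ 2 / (I * ((1 / t : ℝ) : ℂ) / M)) *
        jacobiTheta₂_term n (((e : ℂ) / M) / (I * ((1 / t : ℝ) : ℂ) / M))
          (-1 / (I * ((1 / t : ℝ) : ℂ) / M)) =
      exp (Real.pi * I * (I * t) * (node M (e - n * M) : ℂ) ^ 2) := by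
  have hM : (M : ℂ) ≠ 0 := by exact_mod_cast NeZero.ne M
  have ht' : (t : ℂ) ≠ 0 := by exact_mod_cast ht.ne'
  rw [jacobiTheta₂_term, ← exp_add, ofReal_node_sq]
  congr 1
  push_cast
  have h1 : (I * (1 / (t : ℂ)) / M)⁻¹ = -I * t * M := by
    field_simp
    linear_combination I_sq
  simp only [div_eq_mul_inv (_ : ℂ) (I * (1 / (t : ℂ)) / M), h1]
  field_simp
  linear_combination (Real.pi * t * (e ^ 2 - 2 * n * M * e + n ^ 2 * M ^ 2) -
    Real.pi * t * (e - n * M) ^ 2 : ℂ) * I_sq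

theorem neg_I_mul_cpow_half (M : ℕ) {t : ℝ} (ht : 0 < t) :
    1 / (-I * (I * ((1 / t : ℝ) : ℂ) / M)) ^ (1 / 2 : ℂ) = (√t : ℝ) * (√(M : ℝ) : ℝ) := by
  have h1 : -I * (I * ((1 / t : ℝ) : ℂ) / M) = ((1 / (t * M) : ℝ) : ℂ) := by
    push_cast
    linear_combination (-(1 / (t : ℂ)) / M) * I_sq
  have h2 : (1 / 2 : ℂ) = ((1 / 2 : ℝ) : ℂ) := by push_cast; rfl
  rw [h1, h2, ← ofReal_cpow (by positivity), ← Real.sqrt_eq_rpow, Real.sqrt_div zero_le_one,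
    Real.sqrt_one, Real.sqrt_mul ht.le]
  push_cast
  rw [one_div_one_div]

theorem wTheta_classInd_zero (M : ℕ) [NeZero M] (e : ℤ) {t : ℝ} (ht : 0 < t) :
    wTheta M (classInd M e) 0 (I * t) =
      1 / (√(M : ℝ) : ℂ) * (1 / (√t : ℂ)) * wTheta M (classChar M e) 0 (I * (1 / t : ℝ)) := by
  have hM : (√(M : ℝ) : ℂ) ≠ 0 := by
    exact ofReal_ne_zero.2 (one_div_pos.1 (one_div_sqrt_pos M)).ne'
  have ht' : (√t : ℂ) ≠ 0 := by exact_mod_cast (Real.sqrt_pos.2 ht).ne'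
  rw [wTheta_classChar_zero, jacobiTheta₂_functional_equation, neg_I_mul_cpow_half M ht,
    jacobiTheta₂, mul_assoc ((√t : ℂ) * _), ← tsum_mul_left, wTheta_classInd]
  simp only [exp_mul_jacobiTheta₂_term M e _ ht, pow_zero, one_mul]
  field_simp

theorem wTheta_classInd_one (M : ℕ) [NeZero M] (e : ℤ) {t : ℝ} (ht : 0 < t) :
    wTheta M (classInd M e) 1 (I * t) =
      -I / (√(M : ℝ) : ℂ) * (1 / (t * √t : ℂ)) * wTheta M (classChar M e) 1 (I * (1 / t : ℝ)) := by
  have hM0 : (0 : ℝ) ≤ M := Nat.cast_nonneg M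
  have hM : (√(M : ℝ) : ℂ) ≠ 0 := by
    exact ofReal_ne_zero.2 (one_div_pos.1 (one_div_sqrt_pos M)).ne'
  have hMs : (√(M : ℝ) : ℂ) * √(M : ℝ) = M := by exact_mod_cast Real.mul_self_sqrt hM0
  have ht' : (√t : ℂ) ≠ 0 := by exact_mod_cast (Real.sqrt_pos.2 ht).ne'
  have ht0 : (t : ℂ) ≠ 0 := by exact_mod_cast ht.ne'
  have hMM : (M : ℂ) ≠ 0 := by exact_mod_cast NeZero.ne M
  have hpi : (Real.pi : ℂ) ≠ 0 := by exact_mod_cast Real.pi_ne_zero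
  have hτ : -1 / (I * ((1 / t : ℝ) : ℂ) / M) = ((t * M : ℝ) : ℂ) * I := by
    push_cast
    field_simp
    linear_combination -I_sq
  have him : 0 < (-1 / (I * ((1 / t : ℝ) : ℂ) / M)).im := by
    have hM1 : (0 : ℝ) < M := by exact_mod_cast Nat.pos_of_ne_zero (NeZero.ne M)
    rw [hτ, im_ofReal_mul, I_im]
    positivity
  have h1 := wTheta_classChar_one M e (I * (1 / t : ℝ))
  have h2 := (((hasSum_jacobiTheta₂'_term (((e : ℂ) / M) / (I * ((1 / t : ℝ) : ℂ) / M)) him).sub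
    ((hasSum_jacobiTheta₂_term (((e : ℂ) / M) / (I * ((1 / t : ℝ) : ℂ) / M)) him).mul_left
      (2 * Real.pi * I * (e / M)))).mul_left
    (exp (-Real.pi * I * ((e : ℂ) / M) ^ 2 / (I * ((1 / t : ℝ) : ℂ) / M)))).tsum_eq
  have h3 : wTheta M (classInd M e) 1 (I * t) * (-2 * Real.pi * I / (√(M : ℝ) : ℂ)) =
      exp (-Real.pi * I * ((e : ℂ) / M) ^ 2 / (I * ((1 / t : ℝ) : ℂ) / M)) *
      (jacobiTheta₂' (((e : ℂ) / M) / (I * ((1 / t : ℝ) : ℂ) / M))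
          (-1 / (I * ((1 / t : ℝ) : ℂ) / M)) - 2 * Real.pi * I * (e / M) *
        jacobiTheta₂ (((e : ℂ) / M) / (I * ((1 / t : ℝ) : ℂ) / M))
          (-1 / (I * ((1 / t : ℝ) : ℂ) / M))) := by
    rw [← h2, wTheta_classInd, ← tsum_mul_right]
    refine tsum_congr fun n => ?_
    rw [← exp_mul_jacobiTheta₂_term M e n ht, jacobiTheta₂'_term, pow_one, ofReal_node]
    push_cast
    field_simp
    rw [sq, hMs]
    ring
  rw [jacobiTheta₂'_functional_equation, neg_I_mul_cpow_half M ht] at h1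
  have h4 : 2 * Real.pi * I * wTheta M (classChar M e) 1 (I * (1 / t : ℝ)) =
      1 / (√(M : ℝ) : ℂ) * ((√t : ℝ) * (√(M : ℝ) : ℝ) / (I * ((1 / t : ℝ) : ℂ) / M)) *
        (wTheta M (classInd M e) 1 (I * t) * (-2 * Real.pi * I / (√(M : ℝ) : ℂ))) := by
    rw [h1, h3]
    ring
  have h5 : wTheta M (classChar M e) 1 (I * (1 / t : ℝ)) =
      I * √(M : ℝ) * (t * √t) * wTheta M (classInd M e) 1 (I * t) := by
    have h2pi : (2 * Real.pi * I : ℂ) ≠ 0 := by simp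
    apply mul_left_cancel₀ h2pi
    rw [h4, ← hMs]
    push_cast
    field_simp
    linear_combination (-(wTheta M (classInd M e) 1 (I * t))) * I_sq
  rw [h5]
  field_simp
  linear_combination ((wTheta M (classInd M e) 1 (I * t))) * I_sq

/-- `θ_{0,c}`, `θ_{1,c}` are the images of `θ_{0,ĉ}`, `θ_{1,ĉ}` under `τ ↦ -1/τ`, and `ĉ`
vanishes at `0`. -/
structure ThetaDual (M : ℕ) (c ĉ : ℤ → ℂ) : Prop where
  bounded : ∃ C, ∀ m, ‖c m‖ ≤ C
  bounded_dual : ∃ C, ∀ m, ‖ĉ m‖ ≤ C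
  dual_zero : ĉ 0 = 0
  zero : ∀ t : ℝ, 0 < t → wTheta M c 0 (I * t) =
    1 / (√(M : ℝ) : ℂ) * (1 / (√t : ℂ)) * wTheta M ĉ 0 (I * (1 / t : ℝ))
  one : ∀ t : ℝ, 0 < t → wTheta M c 1 (I * t) =
    -I / (√(M : ℝ) : ℂ) * (1 / (t * √t : ℂ)) * wTheta M ĉ 1 (I * (1 / t : ℝ))

theorem wTheta_sum {M d : ℕ} [NeZero M] (a : Fin d → ℂ) {B : Fin d → ℤ → ℂ} {C : ℝ}
    (hB : ∀ j m, ‖B j m‖ ≤ C) (k : ℕ) {τ : ℂ} (hτ : 0 < τ.im) :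
    wTheta M (fun m => ∑ j, a j * B j m) k τ = ∑ j, a j * wTheta M (B j) k τ := by
  simp only [wTheta]
  rw [← (hasSum_sum fun j _ => ((summable_wTheta (M := M) (hB j) k hτ).hasSum.mul_left (a j))).tsum_eq]
  refine tsum_congr fun m => ?_
  rw [Finset.sum_mul, Finset.sum_mul]
  exact Finset.sum_congr rfl fun j _ => by ring

theorem norm_classInd_le (M : ℕ) (e m : ℤ) : ‖classInd M e m‖ ≤ 1 := by
  rw [classInd]
  split_ifs <;> simp

theorem norm_classChar (M : ℕ) (e m : ℤ) : ‖classChar M e m‖ = 1 := by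
  have : (2 * Real.pi * I * (e * m / M) : ℂ) = ((2 * Real.pi * (e * m / M) : ℝ) : ℂ) * I := by
    push_cast; ring
  rw [classChar, this, norm_exp_ofReal_mul_I]

theorem exists_bound_sum {d : ℕ} (a : Fin d → ℂ) {B : Fin d → ℤ → ℂ} {C : ℝ}
    (hB : ∀ j m, ‖B j m‖ ≤ C) : ∃ C', ∀ m, ‖∑ j, a j * B j m‖ ≤ C' :=
  ⟨∑ j, ‖a j‖ * C, fun m => norm_sum_le_of_le _ fun j _ => by
    rw [norm_mul]
    exact mul_le_mul_of_nonneg_left (hB j m) (norm_nonneg _)⟩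

theorem thetaDual_sum {M d : ℕ} [NeZero M] (a : Fin d → ℂ) (ha : ∑ j, a j = 0)
    (e : Fin d → ℤ) :
    ThetaDual M (fun m => ∑ j, a j * classInd M (e j) m)
      (fun m => ∑ j, a j * classChar M (e j) m) := by
  have h1 : ∀ j m, ‖classInd M (e j) m‖ ≤ 1 := fun j m => norm_classInd_le M (e j) m
  have h2 : ∀ j m, ‖classChar M (e j) m‖ ≤ 1 := fun j m => (norm_classChar M (e j) m).le
  refine ⟨exists_bound_sum a h1, exists_bound_sum a h2, by simpa [classChar] using ha, ?_, ?_⟩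
  · intro t ht
    rw [wTheta_sum a h1 0 (by simpa using ht), wTheta_sum a h2 0 (by simpa using ht),
      Finset.mul_sum]
    refine Finset.sum_congr rfl fun j _ => ?_
    rw [wTheta_classInd_zero M (e j) ht]
    ring
  · intro t ht
    rw [wTheta_sum a h1 1 (by simpa using ht), wTheta_sum a h2 1 (by simpa using ht),
      Finset.mul_sum]
    refine Finset.sum_congr rfl fun j _ => ?_
    rw [wTheta_classInd_one M (e j) ht]
    ring

/-- The function `t ↦ t^{-p/2} θ_{s,ĉ}(i/t)`. -/
noncomputable def dualGen (M : ℕ) (ĉ : ℤ → ℂ) (p s : ℕ) (t : ℝ) : ℂ :=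
  (((√t)⁻¹ : ℝ) : ℂ) ^ p * wTheta M ĉ s (I * (1 / t : ℝ))

/-- The span of the functions `t^{-p/2} θ_{s,ĉ}(i/t)`; it is stable under differentiation. -/
noncomputable def dualSpan (M : ℕ) (ĉ : ℤ → ℂ) : Submodule ℂ (ℝ → ℂ) :=
  Submodule.span ℂ (range fun ps : ℕ × ℕ => dualGen M ĉ ps.1 ps.2)

theorem dualGen_mem (M : ℕ) (ĉ : ℤ → ℂ) (p s : ℕ) : dualGen M ĉ p s ∈ dualSpan M ĉ :=
  Submodule.subset_span ⟨(p, s), rfl⟩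

theorem hasDerivAt_inv_sqrt {t : ℝ} (ht : 0 < t) :
    HasDerivAt (fun t : ℝ => (((√t)⁻¹ : ℝ) : ℂ)) (-(1 / 2) * (((√t)⁻¹ : ℝ) : ℂ) ^ 3) t := by
  have h0 := (Real.sqrt_pos.2 ht).ne'
  have h := ((Real.hasDerivAt_sqrt ht.ne').inv h0).ofReal_comp
  refine h.congr_deriv ?_
  push_cast
  have h0' : (√t : ℂ) ≠ 0 := by exact_mod_cast h0
  field_simp

theorem inv_sqrt_pow_three {t : ℝ} (ht : 0 < t) :
    (((√t)⁻¹ : ℝ) : ℂ) ^ 3 = 1 / (t * √t : ℂ) := by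
  have : ((√t)⁻¹ : ℝ) ^ 3 = 1 / (t * √t) := by
    rw [pow_succ, inv_pow, Real.sq_sqrt ht.le, ← mul_inv, one_div]
  exact_mod_cast this

theorem inv_sqrt_pow_four {t : ℝ} (ht : 0 < t) : (((√t)⁻¹ : ℝ) : ℂ) ^ 4 = 1 / (t : ℂ) ^ 2 := by
  have : ((√t)⁻¹ : ℝ) ^ 4 = 1 / t ^ 2 := by
    rw [show 4 = 2 * 2 from rfl, pow_mul, inv_pow, Real.sq_sqrt ht.le, inv_pow, one_div]
  exact_mod_cast this

theorem hasDerivAt_wTheta_inv {M : ℕ} [NeZero M] {B : ℤ → ℂ} {C : ℝ} (hB : ∀ m, ‖B m‖ ≤ C)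
    (s : ℕ) {t : ℝ} (ht : 0 < t) :
    HasDerivAt (fun t : ℝ => wTheta M B s (I * (1 / t : ℝ)))
      (Real.pi * (1 / (t : ℂ) ^ 2) * wTheta M B (s + 2) (I * (1 / t : ℝ))) t := by
  have h1 : HasDerivAt (fun t : ℝ => 1 / t) (-(t ^ 2)⁻¹) t := by
    simpa using hasDerivAt_inv ht.ne'
  have h := HasDerivAt.scomp t (hasDerivAt_wTheta_axis (M := M) hB s (one_div_pos.2 ht)) h1
  refine h.congr_deriv ?_
  rw [real_smul]
  push_cast
  ring

theorem hasDerivAt_dualGen {M : ℕ} [NeZero M] {ĉ : ℤ → ℂ} {C : ℝ} (hB : ∀ m, ‖ĉ m‖ ≤ C)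
    (p s : ℕ) {t : ℝ} (ht : 0 < t) :
    HasDerivAt (dualGen M ĉ p s)
      (-(p / 2 : ℂ) * dualGen M ĉ (p + 2) s t + Real.pi * dualGen M ĉ (p + 4) (s + 2) t) t := by
  have h := ((hasDerivAt_inv_sqrt ht).pow p).mul (hasDerivAt_wTheta_inv (M := M) hB s ht)
  refine h.congr_deriv ?_
  rw [← inv_sqrt_pow_four ht]
  simp only [dualGen, Pi.pow_apply]
  rcases p with _ | p
  · simp; ring
  · simp only [Nat.add_sub_cancel]
    push_cast
    ring

theorem exists_hasDerivAt_dualSpan {M : ℕ} [NeZero M] {ĉ : ℤ → ℂ} {C : ℝ} (hB : ∀ m, ‖ĉ m‖ ≤ C)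
    {f : ℝ → ℂ} (hf : f ∈ dualSpan M ĉ) :
    ∃ g ∈ dualSpan M ĉ, ∀ t : ℝ, 0 < t → HasDerivAt f (g t) t := by
  induction hf using Submodule.span_induction with
  | mem f h =>
    obtain ⟨⟨p, s⟩, rfl⟩ := h
    exact ⟨-(p / 2 : ℂ) • dualGen M ĉ (p + 2) s + (Real.pi : ℂ) • dualGen M ĉ (p + 4) (s + 2),
      Submodule.add_mem _ (Submodule.smul_mem _ _ (dualGen_mem M ĉ _ _))
        (Submodule.smul_mem _ _ (dualGen_mem M ĉ _ _)), fun t ht => hasDerivAt_dualGen hB p s ht⟩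
  | zero => exact ⟨0, Submodule.zero_mem _, fun t _ => hasDerivAt_const t 0⟩
  | add f₁ f₂ _ _ h₁ h₂ =>
    obtain ⟨g₁, m₁, d₁⟩ := h₁
    obtain ⟨g₂, m₂, d₂⟩ := h₂
    exact ⟨g₁ + g₂, Submodule.add_mem _ m₁ m₂, fun t ht => (d₁ t ht).add (d₂ t ht)⟩
  | smul a f _ h =>
    obtain ⟨g, m, d⟩ := h
    exact ⟨a • g, Submodule.smul_mem _ a m, fun t ht => (d t ht).const_smul a⟩

theorem tendsto_dualSpan {M : ℕ} [NeZero M] {ĉ : ℤ → ℂ} {C : ℝ} (hB : ∀ m, ‖ĉ m‖ ≤ C)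
    (h0 : ĉ 0 = 0) {f : ℝ → ℂ} (hf : f ∈ dualSpan M ĉ) : Tendsto f (𝓝[>] 0) (𝓝 0) := by
  induction hf using Submodule.span_induction with
  | mem f h =>
    obtain ⟨⟨p, s⟩, rfl⟩ := h
    have h1 := (tendsto_wTheta_axis_atTop (M := M) hB s (by rw [h0, zero_mul])
      ((1 / 2 : ℝ) * p)).comp tendsto_inv_nhdsGT_zero
    rw [tendsto_zero_iff_norm_tendsto_zero]
    refine h1.congr' ?_
    filter_upwards [self_mem_nhdsWithin] with t ht
    have ht' : (0 : ℝ) < t := ht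
    simp only [Function.comp_apply, dualGen]
    rw [norm_mul, norm_pow, norm_real, Real.norm_eq_abs, abs_of_nonneg (by positivity),
      Real.rpow_mul (by positivity), Real.rpow_natCast, ← Real.sqrt_eq_rpow, Real.sqrt_inv, one_div]
  | zero => exact tendsto_const_nhds
  | add f₁ f₂ _ _ h₁ h₂ => exact add_zero (0 : ℂ) ▸ h₁.add h₂
  | smul a f _ h => exact smul_zero (A := ℂ) a ▸ h.const_smul a

namespace ThetaDual

variable {M : ℕ} [NeZero M] {c ĉ : ℤ → ℂ}

theorem exists_dualSpan (h : ThetaDual M c ĉ) (k : ℕ) :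
    ∃ f ∈ dualSpan M ĉ, ∀ t : ℝ, 0 < t → wTheta M c k (I * t) = f t := by
  obtain ⟨C, hC⟩ := h.bounded
  obtain ⟨C', hC'⟩ := h.bounded_dual
  induction k using Nat.twoStepInduction with
  | zero =>
    refine ⟨(1 / (√(M : ℝ) : ℂ)) • dualGen M ĉ 1 0, Submodule.smul_mem _ _ (dualGen_mem M ĉ _ _),
      fun t ht => ?_⟩
    rw [h.zero t ht, Pi.smul_apply, smul_eq_mul, dualGen]
    push_cast
    ring
  | one =>
    refine ⟨(-I / (√(M : ℝ) : ℂ)) • dualGen M ĉ 3 1, Submodule.smul_mem _ _ (dualGen_mem M ĉ _ _),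
      fun t ht => ?_⟩
    rw [h.one t ht, Pi.smul_apply, smul_eq_mul, dualGen, inv_sqrt_pow_three ht]
    ring
  | more k ih _ =>
    obtain ⟨f, hf, hfk⟩ := ih
    obtain ⟨g, hg, hd⟩ := exists_hasDerivAt_dualSpan hC' hf
    refine ⟨(-(Real.pi : ℂ)⁻¹) • g, Submodule.smul_mem _ _ hg, fun t ht => ?_⟩
    have h1 : HasDerivAt (fun t : ℝ => wTheta M c k (I * t)) (g t) t :=
      (hd t ht).congr_of_eventuallyEq (by filter_upwards [lt_mem_nhds ht] with s hs using hfk s hs)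
    have h2 := (hasDerivAt_wTheta_axis hC k ht).unique h1
    rw [Pi.smul_apply, smul_eq_mul, ← h2]
    have : (Real.pi : ℂ) ≠ 0 := by exact_mod_cast Real.pi_ne_zero
    field_simp

theorem tendsto_zero (h : ThetaDual M c ĉ) (k : ℕ) :
    Tendsto (fun t : ℝ => wTheta M c k (I * t)) (𝓝[>] 0) (𝓝 0) := by
  obtain ⟨f, hf, hfk⟩ := h.exists_dualSpan k
  obtain ⟨C', hC'⟩ := h.bounded_dual
  refine (tendsto_dualSpan hC' h.dual_zero hf).congr' ?_
  filter_upwards [self_mem_nhdsWithin] with t ht using (hfk t ht).symm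

theorem integrableOn (h : ThetaDual M c ĉ) (k : ℕ) :
    IntegrableOn (fun t : ℝ => wTheta M c (k + 1) (I * t)) (Ioi 0) := by
  obtain ⟨C, hC⟩ := h.bounded
  have h1 : ∀ᶠ t : ℝ in 𝓝[>] (0 : ℝ), ‖wTheta M c (k + 1) (I * t)‖ < 1 := by
    have := (h.tendsto_zero (k + 1)).norm
    rw [norm_zero] at this
    exact this.eventually (gt_mem_nhds (zero_lt_one (α := ℝ)))
  obtain ⟨ε, hε, hsub⟩ := mem_nhdsGT_iff_exists_Ioc_subset.1 h1
  rw [← Ioc_union_Ioi_eq_Ioi (le_of_lt hε)]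
  refine IntegrableOn.union ?_ (integrableOn_wTheta_axis hC (k + 1) (by simp) hε)
  refine Integrable.of_bound (μ := volume.restrict (Ioc 0 ε)) ?_ (1 : ℝ) ?_
  · exact ((continuousOn_wTheta_axis (M := M) hC (k + 1)).mono Ioc_subset_Ioi_self).aestronglyMeasurable
      measurableSet_Ioc
  · filter_upwards [ae_restrict_mem measurableSet_Ioc] with t ht using le_of_lt (hsub ht)

theorem tendsto_atTop (h : ThetaDual M c ĉ) (k : ℕ) :
    Tendsto (fun t : ℝ => wTheta M c (k + 1) (I * t)) atTop (𝓝 0) := by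
  obtain ⟨C, hC⟩ := h.bounded
  have := tendsto_wTheta_axis_atTop (M := M) hC (k + 1) (by simp) 0
  simp only [Real.rpow_zero, one_mul] at this
  exact tendsto_zero_iff_norm_tendsto_zero.2 this

theorem two (h : ThetaDual M c ĉ) {t : ℝ} (ht : 0 < t) :
    wTheta M c 2 (I * t) = -1 / (√(M : ℝ) : ℂ) * (1 / (t * √t : ℂ)) *
      (1 / t * wTheta M ĉ 2 (I * (1 / t : ℝ)) -
        1 / (2 * Real.pi) * wTheta M ĉ 0 (I * (1 / t : ℝ))) := by
  obtain ⟨C, hC⟩ := h.bounded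
  obtain ⟨C', hC'⟩ := h.bounded_dual
  have h1 : HasDerivAt (fun t : ℝ => wTheta M c 0 (I * t)) _ t :=
    ((hasDerivAt_dualGen hC' 1 0 ht).const_mul (1 / (√(M : ℝ) : ℂ))).congr_of_eventuallyEq (by
      filter_upwards [lt_mem_nhds ht] with s hs
      rw [h.zero s hs, dualGen]
      push_cast
      ring)
  have h2 := (hasDerivAt_wTheta_axis hC 0 ht).unique h1
  have hpi : (Real.pi : ℂ) ≠ 0 := by exact_mod_cast Real.pi_ne_zero
  have ht0 : (t : ℂ) ≠ 0 := by exact_mod_cast ht.ne'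
  have h0 : (√t : ℂ) ≠ 0 := by exact_mod_cast (Real.sqrt_pos.2 ht).ne'
  have e5 : (((√t)⁻¹ : ℝ) : ℂ) ^ 5 = 1 / (t * √t : ℂ) * (1 / t) := by
    rw [pow_succ, inv_sqrt_pow_four ht]
    push_cast
    field_simp
  have hneg : (-(Real.pi : ℂ)) ≠ 0 := neg_ne_zero.2 hpi
  apply mul_left_cancel₀ hneg
  rw [zero_add] at h2
  rw [h2, dualGen, dualGen, inv_sqrt_pow_three ht, e5]
  push_cast
  field_simp
  ring

end ThetaDual

theorem continuousOn_wTheta_segment {M : ℕ} [NeZero M] {B : ℤ → ℂ} {C : ℝ}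
    (hB : ∀ m, ‖B m‖ ≤ C) (k : ℕ) :
    ContinuousOn (Function.uncurry fun (z : ℂ) (u : ℝ) => wTheta M B k (z + (u : ℂ) ^ 2 * (I - z)))
      ({τ : ℂ | 0 < τ.im} ×ˢ Icc 0 1) := by
  refine (continuousOn_wTheta (M := M) hB k).comp
    (f := fun p : ℂ × ℝ => p.1 + (p.2 : ℂ) ^ 2 * (I - p.1)) ?_ ?_
  · fun_prop
  · rintro ⟨z, u⟩ ⟨hz, hu⟩
    exact im_segment_pos hz hu

theorem differentiableOn_segIntegral {M : ℕ} [NeZero M] {B : ℤ → ℂ} {C : ℝ}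
    (hB : ∀ m, ‖B m‖ ≤ C) (k : ℕ) :
    DifferentiableOn ℂ (segIntegral M B k) {τ : ℂ | 0 < τ.im} := fun τ hτ => by
  have h := hasDerivAt_integral_unitInterval (isOpen_im_gt 0)
    (F := fun (z : ℂ) (u : ℝ) => wTheta M B k (z + (u : ℂ) ^ 2 * (I - z)))
    (F' := fun (z : ℂ) (u : ℝ) => Real.pi * I * wTheta M B (k + 2) (z + (u : ℂ) ^ 2 * (I - z)) *
      (1 - (u : ℂ) ^ 2))
    (continuousOn_wTheta_segment hB k) ?_ ?_ hτ
  · exact h.differentiableAt.differentiableWithinAt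
  · exact ((continuousOn_wTheta_segment (M := M) hB (k + 2)).const_smul (Real.pi * I : ℂ)).mul
      (g := fun p : ℂ × ℝ => 1 - (p.2 : ℂ) ^ 2) (by fun_prop)
  · intro z hz u hu
    have h1 : HasDerivAt (fun z : ℂ => z + (u : ℂ) ^ 2 * (I - z)) (1 + (u : ℂ) ^ 2 * (-1)) z :=
      (hasDerivAt_id z).add (((hasDerivAt_id z).const_sub I).const_mul _)
    refine (HasDerivAt.comp z (hasDerivAt_wTheta (M := M) hB k (im_segment_pos hz hu))
      h1).congr_deriv ?_
    ring

theorem im_neg_one_div_pos {τ : ℂ} (hτ : 0 < τ.im) : 0 < (-1 / τ).im := by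
  have h0 : τ ≠ 0 := fun h => by simp [h] at hτ
  rw [neg_div, one_div, neg_im, inv_im, neg_div, neg_neg]
  exact div_pos hτ (normSq_pos.2 h0)

/-- Holomorphic functions on the upper half-plane which agree on the imaginary axis agree. -/
theorem eqOn_upperHalfPlane {F G : ℂ → ℂ} (hF : DifferentiableOn ℂ F {τ : ℂ | 0 < τ.im})
    (hG : DifferentiableOn ℂ G {τ : ℂ | 0 < τ.im})
    (h : ∀ y : ℝ, 0 < y → F (I * y) = G (I * y)) : EqOn F G {τ : ℂ | 0 < τ.im} := by
  refine (hF.analyticOnNhd (isOpen_im_gt 0)).eqOn_of_preconnected_of_frequently_eq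
    (hG.analyticOnNhd (isOpen_im_gt 0)) (convex_im_gt 0).isPreconnected (z₀ := I) (by simp) ?_
  have ht : Tendsto (fun y : ℝ => I * (y : ℂ)) (𝓝[≠] 1) (𝓝[≠] I) := by
    refine tendsto_nhdsWithin_iff.2 ⟨?_, ?_⟩
    · have : ContinuousAt (fun y : ℝ => I * (y : ℂ)) 1 := by fun_prop
      have h2 := this.tendsto
      simp only [ofReal_one, mul_one] at h2
      exact h2.mono_left nhdsWithin_le_nhds
    · filter_upwards [self_mem_nhdsWithin] with y hy hyI
      refine hy ?_
      have : I * (y : ℂ) = I * 1 := by rw [mul_one]; exact hyI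
      exact_mod_cast mul_left_cancel₀ I_ne_zero this
  refine ht.frequently (Eventually.frequently ?_)
  filter_upwards [nhdsWithin_le_nhds (lt_mem_nhds one_pos)] with y hy using h y hy

/-- The substitution relating the segments from `i / y` to `i` and from `i y` to `i`. -/
theorem integral_inversion_segment {y : ℝ} (hy : 0 < y) {g : ℝ → ℂ}
    (hg : ContinuousOn g (Ioi 0)) :
    ∫ u in (0 : ℝ)..1, (1 / (((1 + u ^ 2 * (y - 1)) / y * √((1 + u ^ 2 * (y - 1)) / y) : ℝ) : ℂ)) *
        g (1 / ((1 + u ^ 2 * (y - 1)) / y)) =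
      y * ∫ v in (0 : ℝ)..1, g (y + v ^ 2 * (1 - y)) := by
  obtain ⟨t, ht⟩ : ∃ t : ℝ → ℝ, ∀ u, t u = (1 + u ^ 2 * (y - 1)) / y := ⟨_, fun _ => rfl⟩
  simp only [← ht]
  have hyt : ∀ u, y * t u = 1 + u ^ 2 * (y - 1) := fun u => by rw [ht]; field_simp
  have hI : uIcc (0 : ℝ) 1 = Icc 0 1 := uIcc_of_le zero_le_one
  have hpos : ∀ u ∈ Icc (0 : ℝ) 1, 0 < t u := fun u hu => by
    have h1 : u ^ 2 ≤ 1 := by nlinarith [hu.1, hu.2]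
    rw [ht]
    refine div_pos ?_ hy
    rcases h1.lt_or_eq with h | h
    · nlinarith [sq_nonneg u]
    · rw [h]; linarith
  have hdt : ∀ u, HasDerivAt t (2 * u * (y - 1) / y) u := fun u => by
    have := ((((hasDerivAt_id u).pow 2).mul_const (y - 1)).const_add 1).div_const y
    rw [funext ht]
    refine this.congr_deriv ?_
    simp
  have hdv : ∀ u ∈ Icc (0 : ℝ) 1,
      HasDerivAt (fun u => u / √(t u)) (y⁻¹ * (1 / (t u * √(t u)))) u := fun u hu => by
    have h0 := hpos u hu
    have hs := Real.sqrt_pos.2 h0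
    refine ((hasDerivAt_id u).div ((hdt u).sqrt h0.ne') hs.ne').congr_deriv ?_
    have e : √(t u) ^ 2 = t u := Real.sq_sqrt h0.le
    simp only [id]
    rw [e]
    field_simp
    rw [e]
    linear_combination hyt u
  have htc : Continuous t := continuous_iff_continuousAt.2 fun u => (hdt u).continuousAt
  have hsub := intervalIntegral.integral_deriv_smul_comp' (a := 0) (b := 1)
    (f := fun u => u / √(t u)) (f' := fun u => y⁻¹ * (1 / (t u * √(t u))))
    (g := fun v => g (y + v ^ 2 * (1 - y))) (by rw [hI]; exact hdv) ?_ ?_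
  · have e0 : (0 : ℝ) / √(t 0) = 0 := zero_div _
    have e1 : (1 : ℝ) / √(t 1) = 1 := by
      have : t 1 = 1 := by rw [ht]; field_simp; ring
      rw [this, Real.sqrt_one, div_one]
    rw [e0, e1] at hsub
    rw [← hsub, ← intervalIntegral.integral_const_mul]
    refine intervalIntegral.integral_congr fun u hu => ?_
    rw [hI] at hu
    have h0 := hpos u hu
    have hr : y + (u / √(t u)) ^ 2 * (1 - y) = 1 / t u := by
      rw [div_pow, Real.sq_sqrt h0.le]
      field_simp
      linear_combination hyt u
    simp only [Function.comp_apply, hr, real_smul]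
    push_cast
    have : (y : ℂ) ≠ 0 := by exact_mod_cast hy.ne'
    field_simp
  · rw [hI]
    refine continuousOn_const.mul (continuousOn_const.div (by fun_prop) fun u hu => ?_)
    exact mul_ne_zero (hpos u hu).ne' (Real.sqrt_pos.2 (hpos u hu)).ne'
  · rw [hI]
    refine hg.comp (by fun_prop) ?_
    rintro v ⟨u, hu, rfl⟩
    have h0 := hpos u hu
    have hr : y + (u / √(t u)) ^ 2 * (1 - y) = 1 / t u := by
      rw [div_pow, Real.sq_sqrt h0.le]
      field_simp
      linear_combination hyt u
    simp only [mem_Ioi, hr]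
    positivity

theorem segment_axis_inv {y : ℝ} (hy : 0 < y) (u : ℝ) :
    -1 / (I * (y : ℂ)) + (u : ℂ) ^ 2 * (I - -1 / (I * (y : ℂ))) =
      I * (((1 + u ^ 2 * (y - 1)) / y : ℝ) : ℂ) := by
  have : (y : ℂ) ≠ 0 := by exact_mod_cast hy.ne'
  have hI : -1 / (I * (y : ℂ)) = I / y := by
    field_simp
    linear_combination -I_sq
  rw [hI]
  push_cast
  field_simp

theorem segment_axis (y v : ℝ) :
    I * (y : ℂ) + (v : ℂ) ^ 2 * (I - I * (y : ℂ)) = I * ((y + v ^ 2 * (1 - y) : ℝ) : ℂ) := by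
  push_cast
  ring

theorem segment_axis_pos {y : ℝ} (hy : 0 < y) {v : ℝ} (hv : v ∈ Icc (0 : ℝ) 1) :
    0 < y + v ^ 2 * (1 - y) := by
  have h1 : v ^ 2 ≤ 1 := by nlinarith [hv.1, hv.2]
  rcases h1.lt_or_eq with h | h
  · nlinarith [sq_nonneg v]
  · rw [h]; linarith

theorem inversion_segment_pos {y : ℝ} (hy : 0 < y) {u : ℝ} (hu : u ∈ Icc (0 : ℝ) 1) :
    0 < (1 + u ^ 2 * (y - 1)) / y := by
  have h := segment_axis_pos (inv_pos.2 hy) hu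
  have : (1 + u ^ 2 * (y - 1)) / y = y⁻¹ + u ^ 2 * (1 - y⁻¹) := by field_simp
  rwa [this]

theorem segIntegral_axis (M : ℕ) (B : ℤ → ℂ) (k : ℕ) (y : ℝ) :
    segIntegral M B k (I * y) =
      ∫ v in (0 : ℝ)..1, wTheta M B k (I * ((y + v ^ 2 * (1 - y) : ℝ) : ℂ)) := by
  simp only [segIntegral, segment_axis]

theorem integral_segment_parts {M : ℕ} [NeZero M] {B : ℤ → ℂ} {C : ℝ} (hB : ∀ m, ‖B m‖ ≤ C)
    {y : ℝ} (hy : 0 < y) :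
    ∫ v in (0 : ℝ)..1, (((y + v ^ 2 * (1 - y) : ℝ) : ℂ) *
        wTheta M B 2 (I * ((y + v ^ 2 * (1 - y) : ℝ) : ℂ)) -
          1 / (2 * Real.pi) * wTheta M B 0 (I * ((y + v ^ 2 * (1 - y) : ℝ) : ℂ))) =
      y * segIntegral M B 2 (I * y) - 1 / (2 * Real.pi) * wTheta M B 0 I := by
  have hpi : (Real.pi : ℂ) ≠ 0 := by exact_mod_cast Real.pi_ne_zero
  have hI : uIcc (0 : ℝ) 1 = Icc 0 1 := uIcc_of_le zero_le_one
  have hc : ∀ k, ContinuousOn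
      (fun v : ℝ => wTheta M B k (I * ((y + v ^ 2 * (1 - y) : ℝ) : ℂ))) (uIcc 0 1) := fun k => by
    rw [hI]
    exact (continuousOn_wTheta_axis (M := M) hB k).comp (f := fun v : ℝ => y + v ^ 2 * (1 - y))
      (by fun_prop) fun v hv => segment_axis_pos hy hv
  have hd : ∀ v ∈ uIcc (0 : ℝ) 1,
      HasDerivAt (fun v : ℝ => (v : ℂ) * wTheta M B 0 (I * ((y + v ^ 2 * (1 - y) : ℝ) : ℂ)))
        (wTheta M B 0 (I * ((y + v ^ 2 * (1 - y) : ℝ) : ℂ)) + (v : ℂ) *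
          ((2 * v * (1 - y) : ℝ) * (-Real.pi *
            wTheta M B 2 (I * ((y + v ^ 2 * (1 - y) : ℝ) : ℂ))))) v := fun v hv => by
    rw [hI] at hv
    have h1 : HasDerivAt (fun v : ℝ => y + v ^ 2 * (1 - y)) (2 * v * (1 - y)) v := by
      have := (((hasDerivAt_id v).pow 2).mul_const (1 - y)).const_add y
      exact this.congr_deriv (by simp)
    have h2 := HasDerivAt.scomp v (hasDerivAt_wTheta_axis (M := M) hB 0 (segment_axis_pos hy hv)) h1
    refine ((hasDerivAt_id v).ofReal_comp.mul h2).congr_deriv ?_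
    simp only [ofReal_one, one_mul, id, real_smul, zero_add, Function.comp_apply]
  have hparts := intervalIntegral.integral_eq_sub_of_hasDerivAt hd
    (ContinuousOn.intervalIntegrable ((hc 0).add (ContinuousOn.mul (by fun_prop)
      (ContinuousOn.mul (by fun_prop) (continuousOn_const.mul (hc 2))))))
  have e1 : I * ((y + 1 ^ 2 * (1 - y) : ℝ) : ℂ) = I := by push_cast; ring
  rw [e1, ofReal_one, one_mul, ofReal_zero, zero_mul, sub_zero] at hparts
  rw [segIntegral_axis, ← hparts, ← intervalIntegral.integral_const_mul,
    ← intervalIntegral.integral_const_mul, ← intervalIntegral.integral_sub]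
  · refine intervalIntegral.integral_congr fun v _ => ?_
    push_cast
    field_simp
    ring
  · exact ContinuousOn.intervalIntegrable (continuousOn_const.mul (hc 2))
  · exact ContinuousOn.intervalIntegrable (continuousOn_const.mul ((hc 0).add
      (ContinuousOn.mul (by fun_prop)
        (ContinuousOn.mul (by fun_prop) (continuousOn_const.mul (hc 2))))))

namespace ThetaDual

variable {M : ℕ} [NeZero M] {c ĉ : ℤ → ℂ}

theorem segIntegral_one_axis (h : ThetaDual M c ĉ) {y : ℝ} (hy : 0 < y) :
    segIntegral M c 1 (-1 / (I * y)) = -(I * y) / (√(M : ℝ) : ℂ) * segIntegral M ĉ 1 (I * y) := by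
  obtain ⟨C', hC'⟩ := h.bounded_dual
  have hI : uIcc (0 : ℝ) 1 = Icc 0 1 := uIcc_of_le zero_le_one
  have hs := integral_inversion_segment hy (continuousOn_wTheta_axis (M := M) hC' 1)
  have e : segIntegral M c 1 (-1 / (I * y)) = -I / (√(M : ℝ) : ℂ) *
      (y * ∫ v in (0 : ℝ)..1, wTheta M ĉ 1 (I * ((y + v ^ 2 * (1 - y) : ℝ) : ℂ))) := by
    rw [← hs, segIntegral, ← intervalIntegral.integral_const_mul]
    refine intervalIntegral.integral_congr fun u hu => ?_
    rw [hI] at hu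
    rw [segment_axis_inv hy, h.one _ (inversion_segment_pos hy hu), ofReal_mul, mul_assoc]
  rw [e, segIntegral_axis]
  ring

theorem segIntegral_two_axis (h : ThetaDual M c ĉ) {y : ℝ} (hy : 0 < y) :
    segIntegral M c 2 (-1 / (I * y)) = -1 / (√(M : ℝ) : ℂ) * y *
      (y * segIntegral M ĉ 2 (I * y) - 1 / (2 * Real.pi) * wTheta M ĉ 0 I) := by
  obtain ⟨C', hC'⟩ := h.bounded_dual
  have hI : uIcc (0 : ℝ) 1 = Icc 0 1 := uIcc_of_le zero_le_one
  have hs := integral_inversion_segment hy (g := fun r : ℝ => (r : ℂ) * wTheta M ĉ 2 (I * r) -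
    1 / (2 * Real.pi) * wTheta M ĉ 0 (I * r))
    (((continuous_ofReal.continuousOn).mul (continuousOn_wTheta_axis (M := M) hC' 2)).sub
      (continuousOn_const.mul (continuousOn_wTheta_axis (M := M) hC' 0)))
  rw [integral_segment_parts hC' hy] at hs
  rw [mul_assoc, ← hs, segIntegral, ← intervalIntegral.integral_const_mul]
  refine intervalIntegral.integral_congr fun u hu => ?_
  rw [hI] at hu
  rw [segment_axis_inv hy, h.two (inversion_segment_pos hy hu), ofReal_mul, mul_assoc,
    ofReal_div 1, ofReal_one]

theorem differentiableOn_neg_one_div : DifferentiableOn ℂ (fun τ : ℂ => -1 / τ)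
    {τ : ℂ | 0 < τ.im} := fun τ hτ => by
  have h0 : τ ≠ 0 := fun h => by simp [h] at hτ
  exact ((differentiableAt_const _).div differentiableAt_id h0).differentiableWithinAt

theorem segIntegral_one (h : ThetaDual M c ĉ) {τ : ℂ} (hτ : 0 < τ.im) :
    segIntegral M c 1 (-1 / τ) = -τ / (√(M : ℝ) : ℂ) * segIntegral M ĉ 1 τ := by
  obtain ⟨C, hC⟩ := h.bounded
  obtain ⟨C', hC'⟩ := h.bounded_dual
  exact eqOn_upperHalfPlane (F := fun τ => segIntegral M c 1 (-1 / τ))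
    (G := fun τ => -τ / (√(M : ℝ) : ℂ) * segIntegral M ĉ 1 τ)
    ((differentiableOn_segIntegral hC 1).comp differentiableOn_neg_one_div
      fun τ hτ => im_neg_one_div_pos hτ)
    (DifferentiableOn.mul (by fun_prop) (differentiableOn_segIntegral hC' 1))
    (fun y hy => h.segIntegral_one_axis hy) hτ

theorem segIntegral_two (h : ThetaDual M c ĉ) {τ : ℂ} (hτ : 0 < τ.im) :
    segIntegral M c 2 (-1 / τ) = -1 / (√(M : ℝ) : ℂ) * (-I * τ) *
      ((-I * τ) * segIntegral M ĉ 2 τ - 1 / (2 * Real.pi) * wTheta M ĉ 0 I) := by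
  obtain ⟨C, hC⟩ := h.bounded
  obtain ⟨C', hC'⟩ := h.bounded_dual
  refine eqOn_upperHalfPlane (F := fun τ => segIntegral M c 2 (-1 / τ))
    (G := fun τ => -1 / (√(M : ℝ) : ℂ) * (-I * τ) *
      ((-I * τ) * segIntegral M ĉ 2 τ - 1 / (2 * Real.pi) * wTheta M ĉ 0 I))
    ((differentiableOn_segIntegral hC 2).comp differentiableOn_neg_one_div
      fun τ hτ => im_neg_one_div_pos hτ)
    (DifferentiableOn.mul (by fun_prop) (DifferentiableOn.sub
      (DifferentiableOn.mul (by fun_prop) (differentiableOn_segIntegral hC' 2))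
      (differentiableOn_const _)))
    (fun y hy => ?_) hτ
  have e : -I * (I * (y : ℂ)) = y := by linear_combination (-(y : ℂ)) * I_sq
  simp only [e]
  exact h.segIntegral_two_axis hy

end ThetaDual

theorem cpow_half_ofReal_mul {ρ : ℝ} (hρ : 0 < ρ) {z : ℂ} (hz : z ≠ 0) :
    (ρ * z : ℂ) ^ (1 / 2 : ℂ) = (√ρ : ℝ) * z ^ (1 / 2 : ℂ) := by
  have hρ' : (ρ : ℂ) ≠ 0 := by exact_mod_cast hρ.ne'
  have e : (√ρ : ℂ) = (ρ : ℂ) ^ (1 / 2 : ℂ) := by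
    rw [Real.sqrt_eq_rpow, ofReal_cpow hρ.le]; push_cast; rfl
  rw [e, cpow_def_of_ne_zero (mul_ne_zero hρ' hz), cpow_def_of_ne_zero hz,
    cpow_def_of_ne_zero hρ', ← exp_add, log_ofReal_mul hρ hz, ofReal_log hρ.le]
  ring_nf

theorem invSqrt_ofReal_mul {ρ : ℝ} (hρ : 0 < ρ) {z : ℂ} (hz : z ≠ 0) :
    invSqrt (ρ * z) = 1 / (√ρ : ℝ) * invSqrt z := by
  rw [invSqrt, cpow_half_ofReal_mul hρ hz, mul_inv, invSqrt, one_div (√ρ : ℂ)]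

theorem exp_neg_pi_div_four : exp (-(Real.pi / 2) * I * (1 / 2)) = (-I) ^ (1 / 2 : ℂ) := by
  rw [cpow_def_of_ne_zero (neg_ne_zero.2 I_ne_zero), log_neg_I]

/-- The behaviour of the principal square root of `-i(z - w)` under `z ↦ -1/z`, `w ↦ -1/w`. -/
theorem cpow_half_inversion {τ : ℂ} (hτ : 0 < τ.im) (hre : τ.re ≠ 0) {r : ℝ} :
    (1 + r * (I * (-1 / τ))) ^ (1 / 2 : ℂ) * τ ^ (1 / 2 : ℂ) =
      (Real.sign τ.re : ℂ) * (-I) ^ (1 / 2 : ℂ) * (r + I * τ) ^ (1 / 2 : ℂ) := by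
  have h0 : τ ≠ 0 := fun h => by simp [h] at hτ
  set p : ℂ := r + I * τ with hp
  have hpim : p.im = τ.re := by simp [hp]
  have hp0 : p ≠ 0 := fun h => hre (by rw [← hpim, h, zero_im])
  have hz : 1 + r * (I * (-1 / τ)) = p / τ * (-I) := by
    rw [hp]
    field_simp
    linear_combination τ * I_sq
  have hlog : ∀ x : ℂ, exp x = -I → -Real.pi < p.arg - τ.arg + x.im →
      p.arg - τ.arg + x.im ≤ Real.pi →
      (1 + r * (I * (-1 / τ))) ^ (1 / 2 : ℂ) * τ ^ (1 / 2 : ℂ) =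
        exp (x * (1 / 2)) * p ^ (1 / 2 : ℂ) := by
    intro x hx h1 h2
    have e1 : exp (log p - log τ + x) = 1 + r * (I * (-1 / τ)) := by
      rw [exp_add, exp_sub, exp_log hp0, exp_log h0, hx, hz]
    have e2 : log (1 + r * (I * (-1 / τ))) = log p - log τ + x := by
      rw [← e1, log_exp]
      · simpa [log_im] using h1
      · simpa [log_im] using h2
    have hz0 : 1 + r * (I * (-1 / τ)) ≠ 0 := by rw [← e1]; exact exp_ne_zero _
    rw [cpow_def_of_ne_zero hz0, cpow_def_of_ne_zero h0, cpow_def_of_ne_zero hp0, e2,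
      ← exp_add, ← exp_add]
    congr 1
    ring
  have hx1 : exp (-(Real.pi / 2) * I) = -I := by
    rw [neg_mul, exp_neg, exp_pi_div_two_mul_I, inv_I]
  rcases lt_or_gt_of_ne hre with h | h
  · have hp1 : p.arg < 0 := arg_neg_iff.2 (by rw [hpim]; exact h)
    have hp2 := neg_pi_lt_arg p
    have ht1 : Real.pi / 2 < τ.arg := by
      by_contra! hc
      rcases arg_le_pi_div_two_iff.1 hc with h' | h' <;> linarith
    have ht2 := arg_le_pi τ
    have hx2 : exp (-(Real.pi / 2) * I + 2 * Real.pi * I) = -I := by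
      rw [exp_add, hx1, exp_two_pi_mul_I, mul_one]
    have him : (-(Real.pi / 2) * I + 2 * Real.pi * I : ℂ).im = 3 / 2 * Real.pi := by
      have : (-(Real.pi / 2) * I + 2 * Real.pi * I : ℂ) = ((3 / 2 * Real.pi : ℝ) : ℂ) * I := by
        push_cast; ring
      rw [this, im_ofReal_mul, I_im, mul_one]
    rw [hlog _ hx2 (by rw [him]; linarith) (by rw [him]; linarith), Real.sign_of_neg h, add_mul,
      exp_add, exp_neg_pi_div_four]
    have : (2 * Real.pi * I * (1 / 2) : ℂ) = Real.pi * I := by ring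
    rw [this, exp_pi_mul_I]
    push_cast
    ring
  · have hp1 : 0 < p.arg := by
      have h1 : 0 ≤ p.arg := arg_nonneg_iff.2 (by rw [hpim]; exact h.le)
      refine lt_of_le_of_ne h1 fun h2 => ?_
      have := (arg_eq_zero_iff.1 h2.symm).2
      rw [hpim] at this
      exact hre this
    have hp2 := arg_le_pi p
    have ht1 : τ.arg < Real.pi / 2 :=
      (abs_lt.1 (abs_arg_lt_pi_div_two_iff.2 (Or.inl h))).2
    have ht2 : 0 ≤ τ.arg := arg_nonneg_iff.2 hτ.le
    have him : (-(Real.pi / 2) * I : ℂ).im = -(Real.pi / 2) := by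
      have : (-(Real.pi / 2) * I : ℂ) = ((-(Real.pi / 2) : ℝ) : ℂ) * I := by push_cast; ring
      rw [this, im_ofReal_mul, I_im, mul_one]
    rw [hlog _ hx1 (by rw [him]; linarith [Real.pi_pos]) (by rw [him]; linarith [Real.pi_pos]),
      Real.sign_of_pos h, exp_neg_pi_div_four]
    push_cast
    ring

theorem re_neg_one_div_ne_zero {τ : ℂ} (hτ : 0 < τ.im) (hre : τ.re ≠ 0) : (-1 / τ).re ≠ 0 := by
  have h0 : τ ≠ 0 := fun h => by simp [h] at hτ
  rw [neg_div, one_div, neg_re, inv_re]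
  exact neg_ne_zero.2 (div_ne_zero hre (normSq_pos.2 h0).ne')

theorem add_I_mul_mem_slitPlane_of_re (x : ℝ) {w : ℂ} (hw : w.re ≠ 0) :
    (x + I * w : ℂ) ∈ slitPlane := by
  rw [mem_slitPlane_iff]
  right
  simpa using hw

theorem sq_sign {x : ℝ} (hx : x ≠ 0) : (Real.sign x : ℂ) * (Real.sign x : ℂ) = 1 := by
  rcases lt_or_gt_of_ne hx with h | h
  · simp [Real.sign_of_neg h]
  · simp [Real.sign_of_pos h]

theorem invSqrt_inversion {τ : ℂ} (hτ : 0 < τ.im) (hre : τ.re ≠ 0) {r : ℝ} :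
    invSqrt (1 + r * (I * (-1 / τ))) =
      (Real.sign τ.re : ℂ) * (I * (-I) ^ (1 / 2 : ℂ)) * τ ^ (1 / 2 : ℂ) * invSqrt (r + I * τ) := by
  have h0 : τ ≠ 0 := fun h => by simp [h] at hτ
  have h := cpow_half_inversion hτ hre (r := r)
  have hs := sq_sign hre
  have hI : (-I) ^ (1 / 2 : ℂ) * (-I) ^ (1 / 2 : ℂ) = -I := sq_cpow_half _
  have hp : (r + I * τ : ℂ) ^ (1 / 2 : ℂ) ≠ 0 :=
    cpow_half_ne_zero (slitPlane_ne_zero (add_I_mul_mem_slitPlane_of_re r hre))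
  have hz : (1 + r * (I * (-1 / τ))) ^ (1 / 2 : ℂ) ≠ 0 := fun hz => by
    rw [hz, zero_mul] at h
    have h1 : (Real.sign τ.re : ℂ) ≠ 0 := left_ne_zero_of_mul (hs ▸ one_ne_zero)
    exact mul_ne_zero (mul_ne_zero h1 (cpow_half_ne_zero (neg_ne_zero.2 I_ne_zero))) hp h.symm
  rw [invSqrt, invSqrt, ← div_eq_mul_inv, inv_eq_one_div, div_eq_div_iff hz hp]
  linear_combination (-(Real.sign τ.re : ℂ) * (I * (-I) ^ (1 / 2 : ℂ))) * h
    - (r + I * τ) ^ (1 / 2 : ℂ) * hs * I * ((-I) ^ (1 / 2 : ℂ) * (-I) ^ (1 / 2 : ℂ))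
    - (r + I * τ) ^ (1 / 2 : ℂ) * I * hI + (r + I * τ) ^ (1 / 2 : ℂ) * I_sq

theorem integral_Ioo_inversion (F : ℝ → ℂ) :
    ∫ t in Ioo (0 : ℝ) 1, F t = ∫ r in Ioi (1 : ℝ), ((1 / r ^ 2 : ℝ) : ℂ) * F (1 / r) := by
  have himg : (fun r : ℝ => 1 / r) '' Ioi 1 = Ioo 0 1 := by
    ext t
    constructor
    · rintro ⟨r, hr, rfl⟩
      have hr' : (1 : ℝ) < r := hr
      exact ⟨by positivity, (div_lt_one (by linarith)).2 hr'⟩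
    · rintro ⟨h0, h1⟩
      exact ⟨1 / t, (one_lt_div h0).2 h1, one_div_one_div t⟩
  have hd : ∀ r ∈ Ioi (1 : ℝ), HasDerivWithinAt (fun r : ℝ => 1 / r) (-(r ^ 2)⁻¹) (Ioi 1) r :=
    fun r hr => by
      have hr' : (1 : ℝ) < r := hr
      simpa using (hasDerivAt_inv (x := r) (by linarith)).hasDerivWithinAt
  have hinj : InjOn (fun r : ℝ => 1 / r) (Ioi 1) := fun a _ b _ h => by simpa using h
  rw [← himg, integral_image_eq_integral_abs_deriv_smul measurableSet_Ioi hd hinj]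
  refine setIntegral_congr_fun measurableSet_Ioi fun r _ => ?_
  simp only [abs_neg, real_smul]
  rw [abs_of_nonneg (by positivity), one_div (r ^ 2)]

/-- Inversion of the part of the integral near `0`. -/
theorem integral_Ioo_theta_inversion {τ : ℂ} (hτ : 0 < τ.im) (hre : τ.re ≠ 0) {f G : ℝ → ℂ} {K : ℂ}
    (hf : ∀ t : ℝ, 0 < t → f t = K * (1 / (t * √t : ℂ)) * G (1 / t)) :
    ∫ t in Ioo (0 : ℝ) 1, f t * invSqrt (t + I * (-1 / τ)) =
      K * ((Real.sign τ.re : ℂ) * (I * (-I) ^ (1 / 2 : ℂ)) * τ ^ (1 / 2 : ℂ)) *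
        ∫ r in Ioi (1 : ℝ), G r * invSqrt (r + I * τ) := by
  rw [integral_Ioo_inversion, ← integral_const_mul]
  refine setIntegral_congr_fun measurableSet_Ioi fun r hr => ?_
  have hr0 : 0 < r := lt_trans one_pos hr
  have hz : (1 + r * (I * (-1 / τ)) : ℂ) ≠ 0 := by
    refine slitPlane_ne_zero (mem_slitPlane_iff.2 (Or.inr ?_))
    rw [add_im, im_ofReal_mul, one_im, zero_add, I_mul_im]
    exact mul_ne_zero hr0.ne' (re_neg_one_div_ne_zero hτ hre)
  have e1 : (((1 / r : ℝ) : ℂ) + I * (-1 / τ)) = ((1 / r : ℝ) : ℂ) * (1 + r * (I * (-1 / τ))) := by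
    have : (r : ℂ) ≠ 0 := by exact_mod_cast hr0.ne'
    push_cast
    field_simp
  have e2 : (√r : ℂ) ^ 2 = r := by exact_mod_cast Real.sq_sqrt hr0.le
  have hr' : (r : ℂ) ≠ 0 := by exact_mod_cast hr0.ne'
  have hs' : (√r : ℂ) ≠ 0 := by exact_mod_cast (Real.sqrt_pos.2 hr0).ne'
  rw [hf _ (one_div_pos.2 hr0), e1, invSqrt_ofReal_mul (one_div_pos.2 hr0) hz,
    invSqrt_inversion hτ hre, one_div_one_div, Real.sqrt_div zero_le_one, Real.sqrt_one]
  push_cast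
  field_simp
  rw [e2]
  ring

theorem integral_Ioi_zero_eq {F : ℝ → ℂ} (hF : IntegrableOn F (Ioi 0)) :
    ∫ t in Ioi (0 : ℝ), F t = (∫ t in Ioo (0 : ℝ) 1, F t) + ∫ t in Ioi (1 : ℝ), F t := by
  rw [← integral_Ioc_eq_integral_Ioo, ← Ioc_union_Ioi_eq_Ioi (zero_le_one (α := ℝ)),
    setIntegral_union (Ioc_disjoint_Ioi le_rfl) measurableSet_Ioi
      (hF.mono_set Ioc_subset_Ioi_self) (hF.mono_set (Ioi_subset_Ioi zero_le_one))]

theorem integrableOn_id_mul_wTheta_axis {M : ℕ} [NeZero M] {B : ℤ → ℂ} {C : ℝ}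
    (hB : ∀ m, ‖B m‖ ≤ C) (k : ℕ) (h0 : B 0 * (0 : ℂ) ^ k = 0) :
    IntegrableOn (fun r : ℝ => (r : ℂ) * wTheta M B k (I * r)) (Ioi 1) := by
  obtain ⟨D, hD0, hD⟩ := norm_wTheta_axis_le (M := M) hB k h0 one_pos
  have hM : 0 < Real.pi / (M : ℝ) :=
    div_pos Real.pi_pos (by exact_mod_cast Nat.pos_of_ne_zero (NeZero.ne M))
  have h1 := (integrableOn_rpow_mul_exp_neg_mul_rpow (s := 1) (p := 1) (by norm_num) one_pos hM)
  simp only [Real.rpow_one] at h1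
  refine Integrable.mono' ((h1.mono_set (Ioi_subset_Ioi zero_le_one)).const_mul
    (D * Real.exp (Real.pi / M))) ?_ ?_
  · exact (continuous_ofReal.continuousOn.mul ((continuousOn_wTheta_axis (M := M) hB k).mono
      (Ioi_subset_Ioi zero_le_one))).aestronglyMeasurable measurableSet_Ioi
  · filter_upwards [ae_restrict_mem measurableSet_Ioi] with r hr
    have hr' : (1 : ℝ) < r := hr
    rw [norm_mul, norm_real, Real.norm_eq_abs, abs_of_pos (by linarith)]
    refine (mul_le_mul_of_nonneg_left (hD r hr'.le) (by linarith)).trans (le_of_eq ?_)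
    rw [show -(Real.pi / M) * (r - 1) = Real.pi / M + -(Real.pi / M) * r by ring, Real.exp_add]
    ring

theorem integral_Ioi_one_parts {M : ℕ} [NeZero M] {B : ℤ → ℂ} {C : ℝ}
    (hB : ∀ m, ‖B m‖ ≤ C) (h0 : B 0 = 0) {τ : ℂ} (hτ : 1 + I * τ ∈ slitPlane) :
    ∫ r in Ioi (1 : ℝ), (r * wTheta M B 2 (I * r) - 1 / (2 * Real.pi) * wTheta M B 0 (I * r)) *
        invSqrt (r + I * τ) =
      1 / Real.pi * (1 + I * τ) ^ (1 / 2 : ℂ) * wTheta M B 0 I -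
        I * τ * ∫ r in Ioi (1 : ℝ), wTheta M B 2 (I * r) * invSqrt (r + I * τ) := by
  have hpi : (Real.pi : ℂ) ≠ 0 := by exact_mod_cast Real.pi_ne_zero
  obtain ⟨δ, hδ, hball⟩ := exists_ball_slitPlane hτ
  have hker : ∀ t : ℝ, 1 ≤ t → ‖invSqrt (t + I * τ)‖ ≤ (δ ^ (1 / 2 : ℝ))⁻¹ := fun t ht => by
    refine norm_invSqrt_le hδ ?_
    have := (hball _ (Metric.mem_ball_self hδ)).2 (t - 1) (sub_nonneg.2 ht)
    convert this using 2
    push_cast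
    ring
  have hcont : ContinuousOn (fun t : ℝ => invSqrt (t + I * τ)) (Ioi 1) := fun t ht => by
    have h := (hasDerivAt_invSqrt (add_I_mul_mem_slitPlane hτ (le_of_lt ht))).continuousAt
    have h2 : ContinuousAt (fun s : ℝ => (s + I * τ : ℂ)) t := by fun_prop
    exact (ContinuousAt.comp (f := fun s : ℝ => (s + I * τ : ℂ)) h h2).continuousWithinAt
  have hint : ∀ g : ℝ → ℂ, IntegrableOn g (Ioi 1) →
      IntegrableOn (fun r : ℝ => g r * invSqrt (r + I * τ)) (Ioi 1) := fun g hg => by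
    refine Integrable.mul_bdd (c := (δ ^ (1 / 2 : ℝ))⁻¹) hg
      (hcont.aestronglyMeasurable measurableSet_Ioi) ?_
    filter_upwards [ae_restrict_mem measurableSet_Ioi] with s hs using hker s (le_of_lt hs)
  have i0 := integrableOn_wTheta_axis (M := M) hB 0 (by rw [h0, zero_mul]) one_pos
  have i2 := integrableOn_wTheta_axis (M := M) hB 2 (by rw [h0, zero_mul]) one_pos
  have i2' := integrableOn_id_mul_wTheta_axis (M := M) hB 2 (by rw [h0, zero_mul])
  have iG : IntegrableOn (fun r : ℝ => (r * wTheta M B 2 (I * r) -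
      1 / (2 * Real.pi) * wTheta M B 0 (I * r)) * invSqrt (r + I * τ)) (Ioi 1) := hint _ (i2'.sub (i0.const_mul (1 / (2 * Real.pi : ℂ))))
  have iT := hint _ i2
  have hd : ∀ r ∈ Ici (1 : ℝ), HasDerivAt
      (fun r : ℝ => (r + I * τ) ^ (1 / 2 : ℂ) * wTheta M B 0 (I * r))
      (-Real.pi * ((r * wTheta M B 2 (I * r) - 1 / (2 * Real.pi) * wTheta M B 0 (I * r)) *
        invSqrt (r + I * τ)) + (-Real.pi * I * τ) *
          (wTheta M B 2 (I * r) * invSqrt (r + I * τ))) r := fun r hr => by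
    have hs := add_I_mul_mem_slitPlane hτ hr
    have h1 : HasDerivAt (fun s : ℝ => (s + I * τ : ℂ)) 1 r :=
      ((hasDerivAt_id r).ofReal_comp).add_const _
    have h2 := HasDerivAt.comp r (hasDerivAt_cpow_half hs) h1
    have h3 := hasDerivAt_wTheta_axis (M := M) hB 0 (lt_of_lt_of_le one_pos hr)
    refine (h2.mul h3).congr_deriv ?_
    simp only [Function.comp_apply, zero_add]
    rw [cpow_half_eq]
    field_simp
    ring
  have hlim : Tendsto (fun r : ℝ => (r + I * τ) ^ (1 / 2 : ℂ) * wTheta M B 0 (I * r)) atTop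
      (𝓝 0) := by
    have h := (tendsto_wTheta_axis_atTop (M := M) hB 0 (by rw [h0, zero_mul]) 1).const_mul
      ((1 + ‖τ‖) * (δ ^ (1 / 2 : ℝ))⁻¹)
    rw [mul_zero] at h
    refine squeeze_zero_norm' ?_ h
    filter_upwards [eventually_ge_atTop 1] with r hr
    rw [cpow_half_eq, norm_mul, norm_mul, Real.rpow_one]
    have h1 : ‖(r + I * τ : ℂ)‖ ≤ (1 + ‖τ‖) * r := by
      refine (norm_add_le _ _).trans ?_
      rw [norm_real, Real.norm_eq_abs, abs_of_pos (by linarith), norm_mul, norm_I, one_mul]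
      nlinarith [norm_nonneg τ]
    calc ‖(r + I * τ : ℂ)‖ * ‖invSqrt (r + I * τ)‖ * ‖wTheta M B 0 (I * r)‖
        ≤ ((1 + ‖τ‖) * r) * (δ ^ (1 / 2 : ℝ))⁻¹ * ‖wTheta M B 0 (I * r)‖ := by
          gcongr
          exact hker r hr
      _ = _ := by ring
  have key := integral_Ioi_of_hasDerivAt_of_tendsto
    (hd 1 self_mem_Ici).continuousAt.continuousWithinAt (fun r hr => hd r (Ioi_subset_Ici_self hr))
    ((iG.const_mul _).add (iT.const_mul _)) hlim
  rw [integral_add (iG.const_mul _) (iT.const_mul _), integral_const_mul, integral_const_mul,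
    ofReal_one, mul_one] at key
  apply mul_left_cancel₀ (neg_ne_zero.2 hpi)
  linear_combination key + (1 + I * τ) ^ (1 / 2 : ℂ) * wTheta M B 0 I * mul_one_div_cancel hpi

namespace ThetaDual

variable {M : ℕ} [NeZero M] {c ĉ : ℤ → ℂ}

theorem integrableOn_kernel (h : ThetaDual M c ĉ) (k : ℕ) {w : ℂ} (hw : w.re ≠ 0) :
    IntegrableOn (fun t : ℝ => wTheta M c (k + 1) (I * t) * invSqrt (t + I * w)) (Ioi 0) := by
  have hs := add_I_mul_mem_slitPlane_of_re 0 hw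
  rw [ofReal_zero, zero_add] at hs
  exact integrableOn_mul_invSqrt hs le_rfl (h.integrableOn k)

/-- The transformation law for exponent `0`. -/
theorem base_zero (h : ThetaDual M c ĉ) {τ : ℂ} (hτ : 0 < τ.im) (hre : τ.re ≠ 0) :
    wTheta M (fun m => (Real.sign (node M m) : ℂ) * c m) 0 (-1 / τ) +
      (Real.sign τ.re : ℂ) * ((-I) ^ (1 / 2 : ℂ) * τ ^ (1 / 2 : ℂ) / (√(M : ℝ) : ℂ)) *
        wTheta M (fun m => (Real.sign (node M m) : ℂ) * ĉ m) 0 τ =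
      ∫ t in Ioi (0 : ℝ), wTheta M c 1 (I * t) * invSqrt (t + I * (-1 / τ)) := by
  obtain ⟨C, hC⟩ := h.bounded
  obtain ⟨C', hC'⟩ := h.bounded_dual
  have hw := im_neg_one_div_pos hτ
  have hwre := re_neg_one_div_ne_zero hτ hre
  have s1 : 1 + I * (-1 / τ) ∈ slitPlane := by
    simpa using add_I_mul_mem_slitPlane_of_re 1 hwre
  have s2 : 1 + I * τ ∈ slitPlane := by simpa using add_I_mul_mem_slitPlane_of_re 1 hre
  rw [integral_Ioi_zero_eq (h.integrableOn_kernel 0 hwre),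
    integral_Ioo_theta_inversion hτ hre (G := fun r => wTheta M ĉ 1 (I * r)) h.one,
    wTheta_sign_eq hC 0 hw s1, wTheta_sign_eq hC' 0 hτ s2]
  simp only [zero_add]
  rw [h.segIntegral_one hτ]
  have hinv := cpow_half_inversion hτ hre (r := 1)
  rw [ofReal_one, one_mul] at hinv
  have hsq := sq_cpow_half τ
  linear_combination (-2 * τ ^ (1 / 2 : ℂ) / (√(M : ℝ) : ℂ) * segIntegral M ĉ 1 τ) * hinv
    + 2 * (1 + I * (-1 / τ)) ^ (1 / 2 : ℂ) / (√(M : ℝ) : ℂ) * segIntegral M ĉ 1 τ * hsq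
    + (1 / (√(M : ℝ) : ℂ) * (Real.sign τ.re : ℂ) * (-I) ^ (1 / 2 : ℂ) * τ ^ (1 / 2 : ℂ) *
      ∫ r in Ioi (1 : ℝ), wTheta M ĉ 1 (I * r) * invSqrt (r + I * τ)) * I_sq

/-- The transformation law for exponent `1`. -/
theorem base_one (h : ThetaDual M c ĉ) {τ : ℂ} (hτ : 0 < τ.im) (hre : τ.re ≠ 0) :
    wTheta M (fun m => (Real.sign (node M m) : ℂ) * c m) 1 (-1 / τ) -
      (Real.sign τ.re : ℂ) * ((-I) ^ (1 / 2 : ℂ) * (τ * τ ^ (1 / 2 : ℂ)) / (√(M : ℝ) : ℂ)) *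
        wTheta M (fun m => (Real.sign (node M m) : ℂ) * ĉ m) 1 τ =
      ∫ t in Ioi (0 : ℝ), wTheta M c 2 (I * t) * invSqrt (t + I * (-1 / τ)) := by
  obtain ⟨C, hC⟩ := h.bounded
  obtain ⟨C', hC'⟩ := h.bounded_dual
  have hw := im_neg_one_div_pos hτ
  have hwre := re_neg_one_div_ne_zero hτ hre
  have s1 : 1 + I * (-1 / τ) ∈ slitPlane := by
    simpa using add_I_mul_mem_slitPlane_of_re 1 hwre
  have s2 : 1 + I * τ ∈ slitPlane := by simpa using add_I_mul_mem_slitPlane_of_re 1 hre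
  rw [integral_Ioi_zero_eq (h.integrableOn_kernel 1 hwre),
    integral_Ioo_theta_inversion hτ hre (K := -1 / (√(M : ℝ) : ℂ)) (G := fun r =>
      r * wTheta M ĉ 2 (I * r) - 1 / (2 * Real.pi) * wTheta M ĉ 0 (I * r))
      (fun t ht => by rw [h.two ht, ofReal_div 1 t, ofReal_one]),
    integral_Ioi_one_parts hC' h.dual_zero s2,
    wTheta_sign_eq hC 1 hw s1, wTheta_sign_eq hC' 1 hτ s2]
  simp only [Nat.reduceAdd]
  rw [h.segIntegral_two hτ]
  have hinv := cpow_half_inversion hτ hre (r := 1)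
  rw [ofReal_one, one_mul] at hinv
  have hsq := sq_cpow_half τ
  set J := ∫ r in Ioi (1 : ℝ), wTheta M ĉ 2 (I * r) * invSqrt (r + I * τ)
  set A := (1 + I * (-1 / τ)) ^ (1 / 2 : ℂ)
  set u := τ ^ (1 / 2 : ℂ)
  set m := (√(M : ℝ) : ℂ)
  set Q := segIntegral M ĉ 2 τ
  linear_combination (2 * τ * u / m * Q - I * u * wTheta M ĉ 0 I / (m * Real.pi)) * hinv +
    (-2 * τ / m * Q * A + I * A * wTheta M ĉ 0 I / (m * Real.pi)) * hsq +
    (-(Real.sign τ.re : ℂ) * (-I) ^ (1 / 2 : ℂ) * u * τ / m * J -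
      2 / m * A * τ ^ 2 * Q) * I_sq

end ThetaDual

theorem dCoeff_of_le {κ ι r : ℕ} (h : r ≤ κ) : dCoeff κ ι r =
    (4 * Real.pi * I) ^ r * ((2 * κ + ι).factorial : ℂ) /
      (2 ^ κ * ((κ - r).factorial : ℂ) * ((2 * r + ι).factorial : ℂ)) := if_pos h

theorem dCoeff_of_lt {κ ι r : ℕ} (h : κ < r) : dCoeff κ ι r = 0 := if_neg (by omega)

theorem factorial_add_two (n : ℕ) :
    ((n + 2).factorial : ℂ) = (n + 2) * (n + 1) * n.factorial := by
  rw [Nat.factorial_succ, Nat.factorial_succ]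
  push_cast
  ring

theorem dCoeff_succ_zero (κ : ℕ) {ι : ℕ} (hι : ι = 0 ∨ ι = 1) :
    dCoeff (κ + 1) ι 0 = (2 * κ + 2 * ι + 1) * dCoeff κ ι 0 := by
  rw [dCoeff_of_le (Nat.zero_le _), dCoeff_of_le (Nat.zero_le _), Nat.sub_zero, Nat.sub_zero,
    show 2 * (κ + 1) + ι = 2 * κ + ι + 2 by ring, factorial_add_two, Nat.factorial_succ κ]
  have h1 : (κ.factorial : ℂ) ≠ 0 := by exact_mod_cast κ.factorial_ne_zero
  have h2 : ((2 * 0 + ι).factorial : ℂ) ≠ 0 := by exact_mod_cast Nat.factorial_ne_zero _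
  have h3 : (κ + 1 : ℂ) ≠ 0 := by exact_mod_cast κ.succ_ne_zero
  push_cast
  field_simp
  rcases hι with rfl | rfl
  · push_cast; ring
  · push_cast; ring

theorem dCoeff_succ_succ {κ ι r : ℕ} (hι : ι = 0 ∨ ι = 1) (hr : r ≤ κ) :
    dCoeff (κ + 1) ι (r + 1) =
      (2 * κ + 2 * ι + 1 + 2 * (r + 1)) * dCoeff κ ι (r + 1) +
        2 * Real.pi * I * dCoeff κ ι r := by
  have h2 : ((2 * r + ι).factorial : ℂ) ≠ 0 := by exact_mod_cast Nat.factorial_ne_zero _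
  have h4 : ((2 * r + ι : ℕ) + 2 : ℂ) ≠ 0 := by exact_mod_cast (2 * r + ι + 1).succ_ne_zero
  have h5 : ((2 * r + ι : ℕ) + 1 : ℂ) ≠ 0 := by exact_mod_cast (2 * r + ι).succ_ne_zero
  have e1 : 2 * (κ + 1) + ι = 2 * κ + ι + 2 := by ring
  have e2 : 2 * (r + 1) + ι = 2 * r + ι + 2 := by ring
  rcases hr.lt_or_eq with h | rfl
  · obtain ⟨s, rfl⟩ := Nat.exists_eq_add_of_lt h
    rw [dCoeff_of_le (by omega), dCoeff_of_le (by omega), dCoeff_of_le (by omega), e1, e2,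
      show r + s + 1 + 1 - (r + 1) = s + 1 by omega, show r + s + 1 - (r + 1) = s by omega,
      show r + s + 1 - r = s + 1 by omega, factorial_add_two, factorial_add_two (2 * r + ι),
      Nat.factorial_succ s]
    have h1 : (s.factorial : ℂ) ≠ 0 := by exact_mod_cast s.factorial_ne_zero
    have h3 : (s + 1 : ℂ) ≠ 0 := by exact_mod_cast s.succ_ne_zero
    push_cast at h4 h5 ⊢
    field_simp
    rcases hι with rfl | rfl
    · push_cast; ring
    · push_cast; ring
  · rw [dCoeff_of_le le_rfl, dCoeff_of_lt (Nat.lt_succ_self r), dCoeff_of_le le_rfl, e1,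
      Nat.sub_self, Nat.sub_self]
    have h6 : ((2 * r + ι + 2).factorial : ℂ) ≠ 0 := by exact_mod_cast Nat.factorial_ne_zero _
    field_simp
    ring

theorem sum_dCoeff_succ (κ : ℕ) {ι : ℕ} (hι : ι = 0 ∨ ι = 1) (X : ℕ → ℂ) :
    ∑ r ∈ Finset.range (κ + 2), dCoeff (κ + 1) ι r * X r =
      (∑ r ∈ Finset.range (κ + 1), (2 * κ + 2 * ι + 1 + 2 * r) * dCoeff κ ι r * X r) +
        ∑ r ∈ Finset.range (κ + 1), 2 * Real.pi * I * dCoeff κ ι r * X (r + 1) := by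
  have h1 : ∑ r ∈ Finset.range (κ + 1), (2 * κ + 2 * ι + 1 + 2 * r) * dCoeff κ ι r * X r =
      ∑ r ∈ Finset.range (κ + 2), (2 * κ + 2 * ι + 1 + 2 * r) * dCoeff κ ι r * X r := by
    rw [Finset.sum_range_succ _ (κ + 1), dCoeff_of_lt (Nat.lt_succ_self κ)]
    ring
  have h2 : ∑ r ∈ Finset.range (κ + 1), dCoeff (κ + 1) ι (r + 1) * X (r + 1) =
      (∑ r ∈ Finset.range (κ + 1),
        (2 * κ + 2 * ι + 1 + 2 * ((r + 1 : ℕ) : ℂ)) * dCoeff κ ι (r + 1) * X (r + 1)) +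
        ∑ r ∈ Finset.range (κ + 1), 2 * Real.pi * I * dCoeff κ ι r * X (r + 1) := by
    rw [← Finset.sum_add_distrib]
    refine Finset.sum_congr rfl fun r hr => ?_
    rw [dCoeff_succ_succ hι (by simpa [Nat.lt_succ_iff] using hr)]
    push_cast
    ring
  rw [h1, Finset.sum_range_succ', Finset.sum_range_succ' _ (κ + 1), dCoeff_succ_zero κ hι, h2,
    Nat.cast_zero]
  ring

theorem hasDerivAt_pow_mul_sqrt_mul {M : ℕ} [NeZero M] {B : ℤ → ℂ} {C : ℝ}
    (hB : ∀ m, ‖B m‖ ≤ C) (N k : ℕ) {τ : ℂ} (hτ : 0 < τ.im) :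
    ∃ D, HasDerivAt (fun τ : ℂ => τ ^ N * τ ^ (1 / 2 : ℂ) * wTheta M B k τ) D τ ∧
      2 * τ ^ 2 * D = τ ^ (N + 1) * τ ^ (1 / 2 : ℂ) *
        ((2 * N + 1) * wTheta M B k τ + 2 * Real.pi * I * τ * wTheta M B (k + 2) τ) := by
  have hs : τ ∈ slitPlane := mem_slitPlane_iff.2 (Or.inr hτ.ne')
  refine ⟨_, ((hasDerivAt_pow N τ).mul (hasDerivAt_cpow_half hs)).mul
    (hasDerivAt_wTheta hB k hτ), ?_⟩
  simp only [Pi.mul_apply]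
  rw [cpow_half_eq]
  rcases N with _ | N
  · simp; ring
  · simp only [Nat.add_sub_cancel]
    push_cast
    ring

theorem hasDerivAt_neg_one_div {τ : ℂ} (hτ : τ ≠ 0) :
    HasDerivAt (fun τ : ℂ => -1 / τ) (1 / τ ^ 2) τ := by
  have h := (hasDerivAt_inv hτ).neg
  simp only [neg_neg] at h
  refine (h.congr_deriv (one_div _).symm).congr_of_eventuallyEq (Eventually.of_forall fun z => ?_)
  simp [neg_div]

namespace ThetaDual

variable {M : ℕ} [NeZero M] {c ĉ : ℤ → ℂ}

theorem hasDerivAt_integral (h : ThetaDual M c ĉ) (k : ℕ) {τ : ℂ} (hτ : 0 < τ.im)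
    (hre : τ.re ≠ 0) :
    HasDerivAt (fun τ : ℂ =>
        ∫ t in Ioi (0 : ℝ), wTheta M c (k + 1) (I * t) * invSqrt (t + I * (-1 / τ)))
      (Real.pi * I / τ ^ 2 *
        ∫ t in Ioi (0 : ℝ), wTheta M c (k + 2 + 1) (I * t) * invSqrt (t + I * (-1 / τ))) τ := by
  have h0 : τ ≠ 0 := fun h => by simp [h] at hτ
  obtain ⟨C, hC⟩ := h.bounded
  have hs : I * (-1 / τ) ∈ slitPlane := by
    simpa using add_I_mul_mem_slitPlane_of_re 0 (re_neg_one_div_ne_zero hτ hre)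
  have h1 := hasDerivAt_integral_invSqrt
    (fun t ht => hasDerivAt_wTheta_axis (M := M) hC (k + 1) ht) (h.integrableOn k)
    ((h.integrableOn (k + 2)).const_mul (-Real.pi : ℂ)) (h.tendsto_zero (k + 1))
    (h.tendsto_atTop k) hs
  refine (HasDerivAt.comp τ h1 ((hasDerivAt_neg_one_div h0).const_mul I)).congr_deriv ?_
  simp only [mul_assoc (-Real.pi : ℂ)]
  rw [integral_const_mul]
  ring

/-- The transformation law for all exponents `2κ + ι`, from that for the exponent `ι`. -/
theorem transformation (h : ThetaDual M c ĉ) {ι : ℕ} (hι : ι = 0 ∨ ι = 1) (E : ℂ)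
    (hbase : ∀ τ : ℂ, 0 < τ.im → τ.re ≠ 0 →
      wTheta M (fun m => (Real.sign (node M m) : ℂ) * c m) ι (-1 / τ) +
        (Real.sign τ.re : ℂ) * (E * (τ ^ ι * τ ^ (1 / 2 : ℂ)) / (√(M : ℝ) : ℂ)) *
          wTheta M (fun m => (Real.sign (node M m) : ℂ) * ĉ m) ι τ =
      ∫ t in Ioi (0 : ℝ), wTheta M c (ι + 1) (I * t) * invSqrt (t + I * (-1 / τ)))
    (κ : ℕ) {τ : ℂ} (hτ : 0 < τ.im) (hre : τ.re ≠ 0) :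
    wTheta M (fun m => (Real.sign (node M m) : ℂ) * c m) (2 * κ + ι) (-1 / τ) +
      (Real.sign τ.re : ℂ) * (E / ((2 * Real.pi * I) ^ κ * (√(M : ℝ) : ℂ))) *
        ∑ r ∈ Finset.range (κ + 1), dCoeff κ ι r * (τ ^ (κ + ι + r) * τ ^ (1 / 2 : ℂ) *
          wTheta M (fun m => (Real.sign (node M m) : ℂ) * ĉ m) (2 * r + ι) τ) =
      ∫ t in Ioi (0 : ℝ), wTheta M c (2 * κ + ι + 1) (I * t) * invSqrt (t + I * (-1 / τ)) := by
  have hpi : (Real.pi : ℂ) ≠ 0 := by exact_mod_cast Real.pi_ne_zero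
  obtain ⟨C, hC⟩ := h.bounded
  replace hC := norm_sign_mul_le (M := M) hC
  obtain ⟨C', hC'⟩ := h.bounded_dual
  replace hC' := norm_sign_mul_le (M := M) hC'
  induction κ generalizing τ with
  | zero =>
    have hd : dCoeff 0 ι 0 = 1 := by
      have : ((2 * 0 + ι).factorial : ℂ) ≠ 0 := by exact_mod_cast Nat.factorial_ne_zero _
      rw [dCoeff_of_le le_rfl]
      field_simp
      simp
    have hb := hbase τ hτ hre
    simp only [Nat.mul_zero, zero_add, Finset.sum_range_one, hd, pow_zero, one_mul, add_zero]
    rw [← hb]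
    ring
  | succ κ ih =>
    have h0 : τ ≠ 0 := fun h => by simp [h] at hτ
    choose D hD hD2 using fun r : ℕ =>
      hasDerivAt_pow_mul_sqrt_mul (M := M) hC' (κ + ι + r) (2 * r + ι) hτ
    have hev : ∀ᶠ z in 𝓝 τ, 0 < z.im ∧ z.re ≠ 0 ∧ Real.sign z.re = Real.sign τ.re := by
      have h1 : ∀ᶠ z in 𝓝 τ, 0 < z.im := (isOpen_im_gt 0).mem_nhds hτ
      rcases lt_or_gt_of_ne hre with hlt | hgt
      · have h2 : ∀ᶠ z : ℂ in 𝓝 τ, z.re < 0 :=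
          (isOpen_lt continuous_re continuous_const).mem_nhds hlt
        filter_upwards [h1, h2] with z hz1 hz2
        exact ⟨hz1, hz2.ne, by rw [Real.sign_of_neg hz2, Real.sign_of_neg hlt]⟩
      · have h2 : ∀ᶠ z : ℂ in 𝓝 τ, 0 < z.re :=
          (isOpen_lt continuous_const continuous_re).mem_nhds hgt
        filter_upwards [h1, h2] with z hz1 hz2
        exact ⟨hz1, hz2.ne', by rw [Real.sign_of_pos hz2, Real.sign_of_pos hgt]⟩
    have hL := (HasDerivAt.comp τ (hasDerivAt_wTheta (M := M) hC (2 * κ + ι)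
        (im_neg_one_div_pos hτ)) (hasDerivAt_neg_one_div h0)).add
      ((HasDerivAt.fun_sum (u := Finset.range (κ + 1)) fun r _ =>
        (hD r).const_mul (dCoeff κ ι r)).const_mul
        ((Real.sign τ.re : ℂ) * (E / ((2 * Real.pi * I) ^ κ * (√(M : ℝ) : ℂ)))))
    have hR := h.hasDerivAt_integral (2 * κ + ι) hτ hre
    have hLR := hL.unique (hR.congr_of_eventuallyEq (by
      filter_upwards [hev] with z ⟨hz1, hz2, hz3⟩
      rw [← ih hz1 hz2, hz3]
      rfl))
    have hsum : 2 * τ ^ 2 * ∑ r ∈ Finset.range (κ + 1), dCoeff κ ι r * D r =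
        ∑ r ∈ Finset.range (κ + 2), dCoeff (κ + 1) ι r *
          (τ ^ (κ + 1 + ι + r) * τ ^ (1 / 2 : ℂ) *
            wTheta M (fun m => (Real.sign (node M m) : ℂ) * ĉ m) (2 * r + ι) τ) := by
      rw [sum_dCoeff_succ κ hι, ← Finset.sum_add_distrib, Finset.mul_sum]
      refine Finset.sum_congr rfl fun r _ => ?_
      rw [mul_left_comm, hD2, show 2 * (r + 1) + ι = 2 * r + ι + 2 by ring]
      push_cast
      ring
    rw [show 2 * (κ + 1) + ι = 2 * κ + ι + 2 by ring, ← hsum]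
    have e : τ ^ 2 / (Real.pi * I) * (Real.pi * I / τ ^ 2) = 1 := by
      field_simp
    rw [pow_succ]
    linear_combination (τ ^ 2 / (Real.pi * I)) * hLR +
      ((∫ t in Ioi (0 : ℝ), wTheta M c (2 * κ + ι + 2 + 1) (I * t) * invSqrt (t + I * (-1 / τ))) -
        wTheta M (fun m => (Real.sign (node M m) : ℂ) * c m) (2 * κ + ι + 2) (-1 / τ)) * e

end ThetaDual

/-- The element `m / √M` of the dual lattice. -/
noncomputable def dualElem (M : ℕ) (m : ℤ) : dualLattice M :=
  ⟨node M m, AddSubgroup.mem_zmultiples_iff.2 ⟨m, by rw [zsmul_eq_mul, node]⟩⟩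

/-- The class of `m / √M` in `L' / L`. -/
noncomputable def discrClass (M : ℕ) (m : ℤ) : Discr M := QuotientAddGroup.mk (dualElem M m)

theorem dualElem_bijective (M : ℕ) [NeZero M] : Function.Bijective (dualElem M) := by
  refine ⟨fun a b h => ?_, fun ⟨y, hy⟩ => ?_⟩
  · have h1 : node M a = node M b := congrArg Subtype.val h
    exact_mod_cast mul_right_cancel₀ (one_div_sqrt_pos M).ne' h1
  · obtain ⟨b, hb⟩ := AddSubgroup.mem_zmultiples_iff.1 hy
    exact ⟨b, Subtype.ext ((zsmul_eq_mul _ _).symm.trans hb)⟩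

theorem discrClass_surjective (M : ℕ) [NeZero M] : Function.Surjective (discrClass M) :=
  QuotientAddGroup.mk_surjective.comp (dualElem_bijective M).2

theorem discrClass_eq_iff {M : ℕ} [NeZero M] {e m : ℤ} :
    discrClass M m = discrClass M e ↔ (M : ℤ) ∣ m - e := by
  have hM0 : (0 : ℝ) ≤ M := Nat.cast_nonneg M
  have hs : √(M : ℝ) ≠ 0 := (one_div_pos.1 (one_div_sqrt_pos M)).ne'
  have hss : √(M : ℝ) * √(M : ℝ) = M := Real.mul_self_sqrt hM0
  rw [eq_comm, discrClass, discrClass, QuotientAddGroup.eq, AddSubgroup.mem_addSubgroupOf, lattice,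
    AddSubgroup.mem_zmultiples_iff]
  have key : ∀ n : ℤ, n • √(M : ℝ) = ((-dualElem M e + dualElem M m : dualLattice M) : ℝ) ↔
      m - e = M * n := fun n => by
    have h1 : ((-dualElem M e + dualElem M m : dualLattice M) : ℝ) =
        ((m - e : ℤ) : ℝ) * (1 / √(M : ℝ)) := by
      rw [AddSubgroup.coe_add, AddSubgroup.coe_neg]
      simp only [dualElem, node]
      push_cast
      ring
    rw [h1, zsmul_eq_mul, mul_one_div, eq_div_iff hs, mul_assoc, hss]
    constructor
    · intro h
      have : n * (M : ℤ) = m - e := by exact_mod_cast h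
      rw [← this, mul_comm]
    · intro h
      rw [h]
      push_cast
      ring
  exact exists_congr key

theorem tsum_coset {M : ℕ} [NeZero M] (e : ℤ) (G : ℝ → ℂ) :
    ∑' n : Coset (discrClass M e), G n.val = ∑' m : ℤ, classInd M e m * G (node M m) := by
  have h1 := tsum_subtype {n : dualLattice M | (QuotientAddGroup.mk n : Discr M) = discrClass M e}
    (fun n : dualLattice M => G (n : ℝ))
  refine h1.trans ?_
  rw [← (Equiv.ofBijective _ (dualElem_bijective M)).tsum_eq]
  refine tsum_congr fun m => ?_
  rw [Equiv.ofBijective_apply, classInd]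
  by_cases h : (M : ℤ) ∣ m - e
  · rw [if_pos h, one_mul, indicator_of_mem]
    · rfl
    · exact discrClass_eq_iff.2 h
  · rw [if_neg h, zero_mul, indicator_of_notMem]
    exact fun h' => h (discrClass_eq_iff.1 h')

theorem theta_discrClass {M : ℕ} [NeZero M] (e : ℤ) (k : ℕ) (τ : ℂ) :
    theta k (discrClass M e) τ = wTheta M (classInd M e) k τ := by
  rw [theta, tsum_coset e
    (fun x : ℝ => (x : ℂ) ^ k * exp (2 * Real.pi * I * τ * ((x : ℂ) ^ 2 / 2))), wTheta]
  refine tsum_congr fun m => ?_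
  rw [show 2 * Real.pi * I * τ * ((node M m : ℂ) ^ 2 / 2) = Real.pi * I * τ * (node M m : ℂ) ^ 2 by
    ring]
  ring

theorem falseTheta_discrClass {M : ℕ} [NeZero M] (e : ℤ) (k : ℕ) (τ : ℂ) :
    falseTheta k (discrClass M e) τ =
      wTheta M (fun m => (Real.sign (node M m) : ℂ) * classInd M e m) k τ := by
  rw [falseTheta, tsum_coset e (fun x : ℝ => (Real.sign x : ℂ) * (x : ℂ) ^ k *
    exp (2 * Real.pi * I * τ * ((x : ℂ) ^ 2 / 2))), wTheta]
  refine tsum_congr fun m => ?_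
  rw [show 2 * Real.pi * I * τ * ((node M m : ℂ) ^ 2 / 2) = Real.pi * I * τ * (node M m : ℂ) ^ 2 by
    ring]
  ring

theorem thetaComb_eq {M d : ℕ} [NeZero M] (k : ℕ) (e : Fin d → ℤ) (a : Fin d → ℂ) {τ : ℂ}
    (hτ : 0 < τ.im) :
    thetaComb k (fun j => discrClass M (e j)) a τ =
      wTheta M (fun m => ∑ j, a j * classInd M (e j) m) k τ := by
  rw [thetaComb, wTheta_sum a (fun j m => norm_classInd_le M (e j) m) k hτ]
  simp only [theta_discrClass]

theorem falseThetaComb_eq {M d : ℕ} [NeZero M] (k : ℕ) (e : Fin d → ℤ) (a : Fin d → ℂ) {τ : ℂ}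
    (hτ : 0 < τ.im) :
    falseThetaComb k (fun j => discrClass M (e j)) a τ =
      wTheta M (fun m => (Real.sign (node M m) : ℂ) * ∑ j, a j * classInd M (e j) m) k τ := by
  have h := wTheta_sum (M := M) a
    (fun j m => norm_sign_mul_le (M := M) (norm_classInd_le M (e j)) m) k hτ
  rw [falseThetaComb]
  simp only [falseTheta_discrClass]
  rw [← h]
  congr 1
  ext m
  rw [Finset.mul_sum]
  exact Finset.sum_congr rfl fun j _ => by ring

theorem sum_falseTheta_eq {M : ℕ} [NeZero M] (k : ℕ) (b : Discr M → ℂ) {τ : ℂ} (hτ : 0 < τ.im) :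
    ∑ ν, b ν * falseTheta k ν τ =
      wTheta M (fun m => (Real.sign (node M m) : ℂ) * b (discrClass M m)) k τ := by
  choose e he using discrClass_surjective M
  have h1 : ∀ ν, b ν * falseTheta k ν τ = b ν *
      wTheta M (fun m => (Real.sign (node M m) : ℂ) * classInd M (e ν) m) k τ := fun ν => by
    rw [← falseTheta_discrClass, he]
  simp only [h1, wTheta]
  rw [← (hasSum_sum fun ν _ => ((summable_wTheta (M := M)
    (norm_sign_mul_le (norm_classInd_le M (e ν))) k hτ).hasSum.mul_left (b ν))).tsum_eq]
  refine tsum_congr fun m => ?_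
  rw [Finset.sum_eq_single (discrClass M m)]
  · have : (M : ℤ) ∣ m - e (discrClass M m) := discrClass_eq_iff.1 (he _).symm
    rw [classInd, if_pos this]
    ring
  · intro ν _ hν
    have : ¬ (M : ℤ) ∣ m - e ν := fun h => hν (by rw [← he ν]; exact (discrClass_eq_iff.2 h).symm)
    rw [classInd, if_neg this]
    ring
  · intro h
    exact absurd (Finset.mem_univ _) h

theorem pairing_discrClass (M : ℕ) (e m : ℤ) :
    pairing (discrClass M e) (discrClass M m) = classChar M e m := by
  have h : pairing (discrClass M e) (discrClass M m) =
      exp (2 * Real.pi * I * ((node M e * node M m : ℝ) : ℂ)) := rfl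
  rw [h, classChar]
  congr 2
  have : node M e * node M m = e * m / M := by
    rw [node, node, mul_mul_mul_comm, ← sq (1 / √(M : ℝ)), div_pow,
      Real.sq_sqrt (Nat.cast_nonneg M)]
    ring
  rw [this]
  push_cast
  rfl

theorem integrand_eq {M d : ℕ} [NeZero M] (k : ℕ) (e : Fin d → ℤ) (a : Fin d → ℂ) (τ : ℂ) {t : ℝ}
    (ht : 0 < t) :
    integrand k (fun j => discrClass M (e j)) a τ (I * t) =
      wTheta M (fun m => ∑ j, a j * classInd M (e j) m) (k + 1) (I * t) *
        invSqrt (t + I * (-1 / τ)) := by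
  have : -I * (I * (t : ℂ) + 1 / τ) = t + I * (-1 / τ) := by
    linear_combination (-(t : ℂ)) * I_sq
  rw [integrand, thetaComb_eq (k + 1) e a (by simpa using ht), this, invSqrt, div_eq_mul_inv]

end FalseTheta

open FalseTheta in
theorem mainTheorem5 (M : ℕ) [NeZero M] (d : ℕ) (hd : 2 ≤ d)
    (μ : Fin d → FalseTheta.Discr M) (a : Fin d → ℂ) (ha : ∑ j, a j = 0)
    (k κ ι : ℕ) (hι : ι = 0 ∨ ι = 1) (hk : k = 2 * κ + ι)
    (τ : ℂ) (hτ : 0 < τ.im) (hre : τ.re ≠ 0) :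
    MeasureTheory.IntegrableOn
        (fun t : ℝ => FalseTheta.integrand k μ a τ (Complex.I * t)) (Set.Ioi 0) ∧
      FalseTheta.falseThetaComb k μ a (-1 / τ)
        + (Real.sign τ.re : ℂ) *
            ((-1) ^ ι * (-Complex.I) ^ (1 / 2 : ℂ) * τ ^ ((κ : ℂ) + ι + 1 / 2) /
              ((2 * Real.pi * Complex.I) ^ κ * (√(M : ℝ) : ℂ))) *
            ∑ ν : FalseTheta.Discr M,
              (∑ j, a j * FalseTheta.pairing (μ j) ν) *
                ∑ r ∈ Finset.range (κ + 1),
                  FalseTheta.dCoeff κ ι r * τ ^ r * FalseTheta.falseTheta (2 * r + ι) ν τ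
        = -Complex.I * FalseTheta.integralImagAxis (FalseTheta.integrand k μ a τ) := by
  have h0 : τ ≠ 0 := fun h => by simp [h] at hτ
  choose e he using fun j => discrClass_surjective M (μ j)
  obtain rfl : μ = fun j => discrClass M (e j) := funext fun j => (he j).symm
  have h := thetaDual_sum (M := M) a ha e
  have hint := h.integrableOn_kernel k (re_neg_one_div_ne_zero hτ hre)
  refine ⟨hint.congr_fun (fun t ht => (integrand_eq k e a τ ht).symm) measurableSet_Ioi, ?_⟩
  have hR : -Complex.I * integralImagAxis (integrand k (fun j => discrClass M (e j)) a τ) =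
      ∫ t in Set.Ioi (0 : ℝ), wTheta M (fun m => ∑ j, a j * classInd M (e j) m) (k + 1)
        (Complex.I * t) * invSqrt (t + Complex.I * (-1 / τ)) := by
    rw [integralImagAxis, MeasureTheory.integral_mul_const,
      MeasureTheory.setIntegral_congr_fun measurableSet_Ioi
        (fun t ht => integrand_eq k e a τ ht)]
    linear_combination (-∫ t in Set.Ioi (0 : ℝ), wTheta M
      (fun m => ∑ j, a j * classInd M (e j) m) (k + 1)
        (Complex.I * t) * invSqrt (t + Complex.I * (-1 / τ))) * Complex.I_sq
  have hbase : ∀ τ : ℂ, 0 < τ.im → τ.re ≠ 0 →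
      wTheta M (fun m => (Real.sign (node M m) : ℂ) * ∑ j, a j * classInd M (e j) m) ι (-1 / τ) +
        (Real.sign τ.re : ℂ) * (((-1) ^ ι * (-Complex.I) ^ (1 / 2 : ℂ)) *
          (τ ^ ι * τ ^ (1 / 2 : ℂ)) / (√(M : ℝ) : ℂ)) *
          wTheta M (fun m => (Real.sign (node M m) : ℂ) * ∑ j, a j * classChar M (e j) m) ι τ =
      ∫ t in Set.Ioi (0 : ℝ), wTheta M (fun m => ∑ j, a j * classInd M (e j) m) (ι + 1)
        (Complex.I * t) * invSqrt (t + Complex.I * (-1 / τ)) := by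
    intro τ hτ hre
    rcases hι with rfl | rfl
    · rw [← h.base_zero hτ hre]
      ring
    · rw [← h.base_one hτ hre]
      ring
  have hsum : ∑ ν : Discr M, (∑ j, a j * pairing (discrClass M (e j)) ν) *
      ∑ r ∈ Finset.range (κ + 1), dCoeff κ ι r * τ ^ r * falseTheta (2 * r + ι) ν τ =
      ∑ r ∈ Finset.range (κ + 1), dCoeff κ ι r * (τ ^ r *
        wTheta M (fun m => (Real.sign (node M m) : ℂ) * ∑ j, a j * classChar M (e j) m)
          (2 * r + ι) τ) := by
    rw [Finset.sum_congr rfl fun ν _ => Finset.mul_sum _ _ _, Finset.sum_comm]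
    refine Finset.sum_congr rfl fun r _ => ?_
    have hs := sum_falseTheta_eq (2 * r + ι)
      (fun ν : Discr M => ∑ j, a j * pairing (discrClass M (e j)) ν) hτ
    simp only [pairing_discrClass] at hs
    rw [← hs, Finset.mul_sum, Finset.mul_sum]
    exact Finset.sum_congr rfl fun ν _ => by ring
  have hpow : τ ^ ((κ : ℂ) + ι + 1 / 2) = τ ^ (κ + ι) * τ ^ (1 / 2 : ℂ) := by
    rw [Complex.cpow_add _ _ h0, ← Nat.cast_add, Complex.cpow_natCast]
  rw [hR, hsum, falseThetaComb_eq k e a (im_neg_one_div_pos hτ), hk,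
    ← h.transformation hι _ hbase κ hτ hre, hpow]
  congr 1
  rw [Finset.mul_sum, Finset.mul_sum]
  refine Finset.sum_congr rfl fun r _ => ?_
  rw [pow_add τ (κ + ι) r]
  ring
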